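/- Let $[x\cdot y]=x_0y_0-x_1y_1-x_2y_2$ on $\mathbb R^3$ and (bilinearly) on $\mathbb C^3$, and write $x^2=[x\cdot x]$. Let $X=\{x\in\mathbb R^3: x^2=-1\}$ be the one-sheeted hyperboloid with the measure $d\sigma(x)=\frac{dx_1dx_2}{2|x_0|}$ (on both sheets $x_0>0$ and $x_0<0$), and let $X^{(c)}=\{z\in\mathbb C^3: z^2=-1\}$. Write $z=x+iy$ with $x,y\in\mathbb R^3$, let $V^+=\{e\in\mathbb R^3:e^2>0,\ e_0>0\}$, and define the four tuboids $$\mathcal T^{\pm}=\{z\in X^{(c)}: y^2>0,\ \pm y_0>0\},\qquad \mathcal T_{\rightarrow}=\{z\in X^{(c)}: y^2<0,\ \det(e,x,y)<0\},\qquad \mathcal T_{\leftarrow}=\{z\in X^{(c)}: y^2<0,\ \det(e,x,y)>0\},$$ where the sign of $\det(e,x,y)$ is the same for all $e\in V^+$. For $\lambda\ne\mu$ put $$z(\lambda,\mu)=\Bigl(\tfrac{1+\lambda\mu}{\lambda-\mu},\tfrac{1-\lambda\mu}{\lambda-\mu},\tfrac{\lambda+\mu}{\lambda-\mu}\Bigr)\in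 X^{(c)} ,$$ and $\tau^{\varepsilon,\varepsilon'}=\{(\lambda,\mu)\in\mathbb C^2:\varepsilon\,\mathrm{Im}\,\lambda>0,\ \varepsilon'\,\mathrm{Im}\,\mu>0\}$. To $\mathcal T^+,\mathcal T^-,\mathcal T_\rightarrow,\mathcal T_\leftarrow$ correspond the tubes $\tau^{-,+},\tau^{+,-},\tau^{-,-},\tau^{+,+}$, respectively. The Hardy space $H^2(\tau^{\varepsilon,\varepsilon'})$ consists of the holomorphic functions $G$ on the tube with $\sup_{\eta,\eta'>0}\int_{\mathbb R^2}|G(\lambda+i\varepsilon\eta,\mu+i\varepsilon'\eta')|^2d\lambda d\mu<\infty$. A function $F$ on a tuboid with tube $\tau^{\varepsilon,\varepsilon'}$ has the boundary value $f\in L^2(X,d\sigma)$ if, with $\widehat F(\lambda,\mu)=F(z(\lambda,\mu))$, the functions $(\lambda,\mu)\mapsto \frac{\widehat F(\lambda+i\varepsilon\eta,\ \mu+i\varepsilon'\eta')}{(\lambda+i\varepsilon\eta)-(\mu+i\varepsilon'\eta')}$ converge in $L^2(\mathbb R^2,d\lambda d\mu)$ to $\frac{f(z(\lambda,\mu))}{\lambda-\mu}$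 as $(\eta,\eta')\to0$ with $\eta,\eta'>0$. The Hardy space $H^2$ of a tuboid consists of the functions $F$ that are holomorphic on it, have a boundary value in $L^2(X,d\sigma)$, and for which $(\lambda-\mu)^{-1}\widehat F(\lambda,\mu)$ is, for $\lambda\neq\mu$, given by a function in $H^2$ of the corresponding tube. **Theorem 1.** Every $f\in L^2(X,d\sigma)$ admits a decomposition $$f=f^++f^-+f_\rightarrow+f_\leftarrow$$ in $L^2(X,d\sigma)$, in which each component $f_{(tub)}$ is the boundary value of a holomorphic function $F_{(tub)}$ belonging to the Hardy space $H^2$ of the corresponding tuboid $\mathcal T^+,\mathcal T^-,\mathcal T_\rightarrow,\mathcal T_\leftarrow$. Moreover, for every $z$ in that tuboid, $$F_{(tub)}(z)=\frac{\epsilon_{(tub)}}{\pi^2}\int_X\frac{f(x)}{(x-z)^2}\,d\sigma(x)=\frac{\epsilon_{(tub)}}{\pi^2}\int_X\frac{f_{(tub)}(x)}{(x-z)^2}\,d\sigma(x),$$ where both integrals converge absolutely, $(x-z)^2=[(x-z)\cdot(x-z)]$, and $\epsilon_{(tub)}=-1$ for $\mathcal T^\pm$, $\epsilon_{(tub)}=+1$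 for $\mathcal T_\rightarrow$ and $\mathcal T_\leftarrow$. -/

import Mathlib

open MeasureTheory Filter Topology
open scoped ENNReal NNReal

noncomputable section

/-- The Minkowskian bilinear form `[x·y] = x₀y₀ - x₁y₁ - x₂y₂` on `K³` (`K = ℝ` or `ℂ`). -/
def mform {K : Type*} [CommRing K] (x y : Fin 3 → K) : K :=
  x 0 * y 0 - x 1 * y 1 - x 2 * y 2

/-- The quadric `[x·x] = -1`: the one-sheeted hyperboloid `X` for `K = ℝ`, its complexification
`X⁽ᶜ⁾` for `K = ℂ`. -/
def quadric (K : Type*) [CommRing K] : Set (Fin 3 → K) :=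
  {x | mform x x = -1}

/-- The real part `x` of `z = x + iy`. -/
def rePart (z : Fin 3 → ℂ) : Fin 3 → ℝ := fun i => (z i).re

/-- The imaginary part `y` of `z = x + iy`. -/
def imPart (z : Fin 3 → ℂ) : Fin 3 → ℝ := fun i => (z i).im

/-- The inclusion `ℝ³ ⊆ ℂ³`. -/
def toComplex (x : Fin 3 → ℝ) : Fin 3 → ℂ := fun i => (x i : ℂ)

/-- The open future cone `V⁺`. -/
def futureCone : Set (Fin 3 → ℝ) := {e | 0 < mform e e ∧ 0 < e 0}

/-- The part of `dσ = dx₁ dx₂ / (2 |x₀|)` carried by the half `x₀ = s √(x₁² + x₂² - 1)`,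
`s = ±1`, of the hyperboloid, as a measure on `ℝ³`. -/
def sheetMeasure (s : ℝ) : Measure (Fin 3 → ℝ) :=
  Measure.map
    (fun p : ℝ × ℝ => ![s * √(p.1 ^ 2 + p.2 ^ 2 - 1), p.1, p.2])
    (((volume : Measure (ℝ × ℝ)).restrict {p : ℝ × ℝ | 1 < p.1 ^ 2 + p.2 ^ 2}).withDensity
      (fun p => ENNReal.ofReal (1 / (2 * √(p.1 ^ 2 + p.2 ^ 2 - 1)))))

/-- The invariant measure `dσ` of the hyperboloid `X`, as a measure on `ℝ³` that is carried by
`X`. Hence `L²(X, dσ)` is `Lp ℂ 2 hypMeasure`. -/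
def hypMeasure : Measure (Fin 3 → ℝ) := sheetMeasure 1 + sheetMeasure (-1)

/-- The four tuboids: `T⁺`, `T⁻`, `T_→`, `T_←`. -/
inductive Tuboid : Type
  | plus : Tuboid
  | minus : Tuboid
  | right : Tuboid
  | left : Tuboid

/-- The four tuboids as subsets of the complex quadric. For the chiral ones the sign of
`Det(e, x, y)` is the same for all `e` in the open future cone. -/
def Tuboid.domain : Tuboid → Set (Fin 3 → ℂ)
  | .plus => {z | z ∈ quadric ℂ ∧ 0 < mform (imPart z) (imPart z) ∧ 0 < imPart z 0}
  | .minus => {z | z ∈ quadric ℂ ∧ 0 < mform (imPart z) (imPart z) ∧ imPart z 0 < 0}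
  | .right => {z | z ∈ quadric ℂ ∧ mform (imPart z) (imPart z) < 0 ∧
      ∀ e ∈ futureCone, Matrix.det (Matrix.of ![e, rePart z, imPart z]) < 0}
  | .left => {z | z ∈ quadric ℂ ∧ mform (imPart z) (imPart z) < 0 ∧
      ∀ e ∈ futureCone, 0 < Matrix.det (Matrix.of ![e, rePart z, imPart z])}

/-- The sign in front of the Cauchy-type integral: `-` for the Lorentz tuboids, `+` for the chiral
ones. -/
def Tuboid.sign : Tuboid → ℂ
  | .plus => -1
  | .minus => -1
  | .right => 1
  | .left => 1

/-- The parametrization `(l, m) ↦ z(l, m)` of the quadric off `z₀ + z₁ = 0`, for `l ≠ m`. -/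
def quadricParam {K : Type*} [Field K] (l m : K) : Fin 3 → K :=
  ![(1 + l * m) / (l - m), (1 - l * m) / (l - m), (l + m) / (l - m)]

/-- The signs `(ε_l, ε_m)` of the tube in the `(l, m)`-space that corresponds to a tuboid. -/
def Tuboid.eps : Tuboid → ℝ × ℝ
  | .plus => (-1, 1)
  | .minus => (1, -1)
  | .right => (-1, -1)
  | .left => (1, 1)

/-- The tube `{(l, m) : ε.1 Im l > 0, ε.2 Im m > 0}`. -/
def tube (ε : ℝ × ℝ) : Set (ℂ × ℂ) :=
  {w | 0 < ε.1 * w.1.im ∧ 0 < ε.2 * w.2.im}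

/-- The point of the tube with signs `ε` over the real point `p`, at heights `η`. -/
def tubePoint (ε η p : ℝ × ℝ) : ℂ × ℂ :=
  (⟨p.1, ε.1 * η.1⟩, ⟨p.2, ε.2 * η.2⟩)

/-- The Hardy space `H²` of a tube: holomorphic functions whose `L²` norms on the translates
of `ℝ²` in the tube are bounded. -/
def tubeHardy (ε : ℝ × ℝ) : Set (ℂ × ℂ → ℂ) :=
  {G | DifferentiableOn ℂ G (tube ε) ∧
    ∃ C : ℝ≥0, ∀ η : ℝ × ℝ, 0 < η.1 → 0 < η.2 →
      ∫⁻ p : ℝ × ℝ, ‖G (tubePoint ε η p)‖ₑ ^ 2 ≤ C}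

/-- Holomorphy of a function on a (relatively open) subset `T` of the complex quadric: locally it
is the restriction of a function holomorphic in an open set of `ℂ³`. -/
def HolomorphicOnQuadric (F : (Fin 3 → ℂ) → ℂ) (T : Set (Fin 3 → ℂ)) : Prop :=
  ∀ z ∈ T, ∃ Φ : (Fin 3 → ℂ) → ℂ, AnalyticAt ℂ Φ z ∧ F =ᶠ[𝓝[T] z] Φ

/-- The function `(l - m)⁻¹ F(z(l, m))`. -/
def weightedPullback (F : (Fin 3 → ℂ) → ℂ) (w : ℂ × ℂ) : ℂ :=
  (w.1 - w.2)⁻¹ * F (quadricParam w.1 w.2)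

/-- `f` is the boundary value of `F` from the tuboid `t`, in the sense of `L²(X, dσ)`. The map
`f ↦ (l - m)⁻¹ f(x(l, m))` is the isometry of `L²(X, dσ)` onto `L²(ℝ²)`, and the functions
`(l - m)⁻¹ F(z(l, m))` on the translates of `ℝ²` in the tube have to converge to the image of `f`
in `L²(ℝ²)` as the translate tends to `ℝ²` in any way inside the tube. -/
def IsBoundaryValue (t : Tuboid) (F : (Fin 3 → ℂ) → ℂ) (f : Lp ℂ 2 hypMeasure) : Prop :=
  Tendsto
    (fun η : ℝ × ℝ => ∫⁻ p : ℝ × ℝ,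
      ‖weightedPullback F (tubePoint t.eps η p)
        - ((p.1 - p.2 : ℝ) : ℂ)⁻¹ * f (quadricParam p.1 p.2)‖ₑ ^ 2)
    (𝓝[{η : ℝ × ℝ | 0 < η.1 ∧ 0 < η.2}] 0) (𝓝 0)

/-- The Hardy space `H²` of a tuboid: `F` is holomorphic in the tuboid, has a boundary value in
`L²(X, dσ)`, and `(l - m)⁻¹ F(z(l, m))` belongs to the Hardy space of the corresponding tube (from
which the diagonal `l = m`, which stands for points at infinity, is missing for the chiral
tuboids). -/
def tuboidHardy (t : Tuboid) : Set ((Fin 3 → ℂ) → ℂ) :=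
  {F | HolomorphicOnQuadric F t.domain ∧
    (∃ f : Lp ℂ 2 hypMeasure, IsBoundaryValue t F f) ∧
    ∃ G ∈ tubeHardy t.eps, ∀ w ∈ tube t.eps, w.1 ≠ w.2 → G w = weightedPullback F w}

/-- The integrand `f(x) / (x - z)²` of the Cauchy-type integral. -/
def cauchyIntegrand (f : Lp ℂ 2 hypMeasure) (z : Fin 3 → ℂ) (x : Fin 3 → ℝ) : ℂ :=
  f x / mform (toComplex x - z) (toComplex x - z)

end

/-!
In the coordinates `(l, m)` the theorem is the decomposition of `L²(ℝ²)` into the boundary values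
of the Hardy spaces of the four tubes over the quadrants.

The invariant measure of the hyperboloid becomes `dl dm / (l - m)²` (`hypMeasure_eq_map`, from the
Jacobian of the parametrization on each sheet), so that `f ↦ (l - m)⁻¹ f` is an isometry onto
`L²(ℝ²)`. The Minkowskian distance factorizes,
`(x - z)² = -4 (l - λ) (m - μ) / ((l - m) (λ - μ))` (`mform_quadricParam_sub`), which turns the
Cauchy-type integral on the hyperboloid, times `(λ - μ)⁻¹`, into the double Cauchy integral
`tubeCauchy` with kernel `1 / ((l - λ) (m - μ))` (`integral_cauchyIntegrand`). Every point of a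
tuboid has coordinates `(λ, μ)`, and they lie in the corresponding tube (`quadricCoord_mem_tube`).

On `ℝ²` everything happens on the Fourier side. The Cauchy kernel is, up to conjugation, a multiple
of the inverse Fourier transform of an exponential cut off to one quadrant
(`planeFourierInv_quadrantExp`), so by Plancherel the Cauchy integral of `g` at `w` is the integral
of the Fourier transform of `g` against `e^{2πi w·ξ}` over
that quadrant (`tubeCauchy_eq_integral_quadrantExp`). At fixed heights it is therefore a damped
version of the projection `hardyProj`, which cuts the Fourier transform off to the quadrant; the
uniform `L²` bound and the boundary value follow by domination. The four quadrants cover the plane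
up to a null set, which gives the decomposition, and the cut-off does not change the Cauchy
integral, which gives the second integral formula.
-/

/-! ### The Fourier transform of `L²(ℝ × ℝ)` -/

section FourierPlane

open FourierTransform SchwartzMap
open scoped ContDiff

/-- On `L¹ ∩ L²` the inverse Fourier transform of `L²` is given by the Fourier integral: both sides
define the same tempered distribution. -/
theorem fourierInv_toLp_ae_eq {V : Type*} [NormedAddCommGroup V] [InnerProductSpace ℝ V]
    [FiniteDimensional ℝ V] [MeasurableSpace V] [BorelSpace V] {f : V → ℂ}
    (h1 : Integrable f) (h2 : MemLp f 2) :
    (𝓕⁻ (h2.toLp f) : Lp ℂ 2 (volume : Measure V)) =ᵐ[volume] 𝓕⁻ f := by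
  have hcont : Continuous (𝓕⁻ f) := by
    have := (Real.Lp.fourierTransformInv ((memLp_one_iff_integrable.2 h1).toLp f)).continuous
    rwa [Real.Lp.fourierTransformInv_toLp] at this
  refine ae_eq_of_integral_contDiff_smul_eq
    ((Lp.memLp _).locallyIntegrable (by norm_num)) hcont.locallyIntegrable fun g hg hgc => ?_
  have hgs : HasCompactSupport (fun x => (g x : ℂ)) := hgc.comp_left Complex.ofReal_zero
  have hgd : ContDiff ℝ ∞ (fun x => (g x : ℂ)) := Complex.ofRealCLM.contDiff.comp hg
  set φ : 𝓢(V, ℂ) := hgs.toSchwartzMap hgd with hφ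
  have hφ' : ∀ x, φ x = (g x : ℂ) := fun x => rfl
  have key := congrArg (fun T => T φ) (Lp.fourierInv_toTemperedDistribution_eq (h2.toLp f))
  simp only [TemperedDistribution.fourierInv_apply, Lp.toTemperedDistribution_apply] at key
  have e1 : ∫ x, g x • (𝓕⁻ (h2.toLp f) : Lp ℂ 2 (volume : Measure V)) x
      = ∫ x, φ x • (𝓕⁻ (h2.toLp f) : Lp ℂ 2 (volume : Measure V)) x := by
    simp [hφ']
  have e2 : ∫ x, (𝓕⁻ φ) x • (h2.toLp f) x = ∫ x, (𝓕⁻ φ) x • f x := by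
    refine integral_congr_ae ?_
    filter_upwards [h2.coeFn_toLp] with x hx
    rw [hx]
  have e3 : ∫ x, (𝓕⁻ φ) x • f x = ∫ x, φ x • 𝓕⁻ f x := by
    have := VectorFourier.integral_fourierIntegral_smul_eq_flip (μ := (volume : Measure V))
      (ν := (volume : Measure V)) (L := -innerₗ V) (f := φ) (g := f) Real.continuous_fourierChar
      (by simpa using! (continuous_fst.inner continuous_snd).neg) φ.integrable h1
    have hflip : (-innerₗ V).flip = -innerₗ V := by
      ext x y; simp [real_inner_comm]
    rw [hflip] at this
    simpa [fourierInv_coe] using! this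
  rw [e1, ← key, e2, e3]
  simp [hφ']

/-- The identification of `L²(ℝ × ℝ)` with `L²` of the Euclidean plane. -/
noncomputable def euclideanLpEquiv :
    Lp ℂ 2 (volume : Measure (WithLp 2 (ℝ × ℝ))) ≃ₗᵢ[ℂ] Lp ℂ 2 (volume : Measure (ℝ × ℝ)) :=
  LinearIsometryEquiv.ofSurjective
    (Lp.compMeasurePreservingₗᵢ ℂ (WithLp.toLp 2) (WithLp.volume_preserving_toLp ℝ ℝ)) fun g =>
      ⟨Lp.compMeasurePreserving (WithLp.ofLp) (WithLp.volume_preserving_ofLp ℝ ℝ) g, by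
        refine Lp.ext ?_
        have h1 := Lp.coeFn_compMeasurePreserving g (WithLp.volume_preserving_ofLp ℝ ℝ)
        have h2 := Lp.coeFn_compMeasurePreserving
          (Lp.compMeasurePreserving (WithLp.ofLp) (WithLp.volume_preserving_ofLp ℝ ℝ) g)
          (WithLp.volume_preserving_toLp ℝ ℝ)
        have h3 := (WithLp.volume_preserving_toLp ℝ ℝ).quasiMeasurePreserving.ae_eq_comp h1
        exact h2.trans h3⟩

/-- The inverse Fourier transform as a unitary operator of `L²(ℝ × ℝ)`, with the normalization
`∫ e^{2πi x·ξ} f(ξ) dξ`. -/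
noncomputable def planeFourierInv :
    Lp ℂ 2 (volume : Measure (ℝ × ℝ)) ≃ₗᵢ[ℂ] Lp ℂ 2 (volume : Measure (ℝ × ℝ)) :=
  (euclideanLpEquiv.symm.trans (Lp.fourierTransformₗᵢ _ _).symm).trans euclideanLpEquiv

theorem planeFourierInv_toLp_ae_eq {f : ℝ × ℝ → ℂ} (h1 : Integrable f) (h2 : MemLp f 2) :
    planeFourierInv (h2.toLp f) =ᵐ[volume]
      fun p => ∫ ξ : ℝ × ℝ, Complex.exp (2 * Real.pi * Complex.I * (p.1 * ξ.1 + p.2 * ξ.2)) * f ξ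
      := by
  have mpO := WithLp.volume_preserving_ofLp ℝ ℝ
  have mpT := WithLp.volume_preserving_toLp ℝ ℝ
  have k1 : Integrable (f ∘ WithLp.ofLp) (volume : Measure (WithLp 2 (ℝ × ℝ))) :=
    mpO.integrable_comp_of_integrable h1
  have k2 : MemLp (f ∘ WithLp.ofLp) 2 (volume : Measure (WithLp 2 (ℝ × ℝ))) :=
    h2.comp_measurePreserving mpO
  have e1 : euclideanLpEquiv.symm (h2.toLp f) = k2.toLp _ := by
    rw [LinearIsometryEquiv.symm_apply_eq]
    refine Lp.ext ?_
    have a1 := Lp.coeFn_compMeasurePreserving (k2.toLp _) mpT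
    have a2 := mpT.quasiMeasurePreserving.ae_eq_comp k2.coeFn_toLp
    exact h2.coeFn_toLp.trans ((a1.trans a2).symm)
  have e2 : planeFourierInv (h2.toLp f) = euclideanLpEquiv (𝓕⁻ (k2.toLp _)) := by
    simp only [planeFourierInv, LinearIsometryEquiv.trans_apply, e1]
    rfl
  rw [e2]
  have a1 := Lp.coeFn_compMeasurePreserving (𝓕⁻ (k2.toLp (f ∘ WithLp.ofLp))) mpT
  have a2 := mpT.quasiMeasurePreserving.ae_eq_comp (fourierInv_toLp_ae_eq k1 k2)
  refine (a1.trans a2).trans (Eventually.of_forall fun p => ?_)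
  have me : MeasurableEmbedding (WithLp.ofLp : WithLp 2 (ℝ × ℝ) → ℝ × ℝ) :=
    (MeasurableEquiv.toLp 2 (ℝ × ℝ)).symm.measurableEmbedding
  simp only [Function.comp_apply]
  rw [Real.fourierInv_eq', ← mpO.integral_comp me]
  refine integral_congr_ae (Eventually.of_forall fun ξ => ?_)
  simp only [Function.comp_apply, smul_eq_mul, WithLp.prod_inner_apply, real_inner_eq_re_inner]
  congr 2
  simp
  ring

end FourierPlane

/-! ### Exponentials on the quadrants and the Cauchy kernel -/

theorem Tuboid.eps_fst_eq (t : Tuboid) : t.eps.1 = 1 ∨ t.eps.1 = -1 := by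
  cases t <;> simp [Tuboid.eps]

theorem Tuboid.eps_snd_eq (t : Tuboid) : t.eps.2 = 1 ∨ t.eps.2 = -1 := by
  cases t <;> simp [Tuboid.eps]

theorem Tuboid.sign_eq_eps_mul (t : Tuboid) : t.sign = (t.eps.1 : ℂ) * (t.eps.2 : ℂ) := by
  cases t <;> simp [Tuboid.eps, Tuboid.sign]

/-- The function `x ↦ e^{2πi a x}` cut off to the half-line `s x > 0`. -/
noncomputable def halfLineExp (s : ℝ) (a : ℂ) : ℝ → ℂ :=
  {x : ℝ | 0 < s * x}.indicator fun x => Complex.exp (2 * Real.pi * Complex.I * a * x)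

theorem two_pi_I_mul_re (a : ℂ) : (2 * Real.pi * Complex.I * a).re = -(2 * Real.pi * a.im) := by
  simp

theorem halfLineExp_integrable_and_integral {s : ℝ} (hs : s = 1 ∨ s = -1) {a : ℂ}
    (ha : 0 < s * a.im) :
    Integrable (halfLineExp s a) ∧
      ∫ x, halfLineExp s a x = -s / (2 * Real.pi * Complex.I * a) := by
  rcases hs with rfl | rfl
  · have hset : {x : ℝ | 0 < 1 * x} = Set.Ioi 0 := by ext; simp
    have hre : (2 * Real.pi * Complex.I * a).re < 0 := by
      rw [two_pi_I_mul_re]; have := Real.pi_pos; have : 0 < a.im := by linarith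
      simp; positivity
    unfold halfLineExp
    rw [hset, integrable_indicator_iff measurableSet_Ioi, integral_indicator measurableSet_Ioi]
    refine ⟨integrableOn_exp_mul_complex_Ioi hre 0, ?_⟩
    rw [integral_exp_mul_complex_Ioi hre 0]
    simp
  · have hset : {x : ℝ | 0 < (-1 : ℝ) * x} = Set.Iio 0 := by ext; simp
    have hre : 0 < (2 * Real.pi * Complex.I * a).re := by
      rw [two_pi_I_mul_re]; have := Real.pi_pos; have : a.im < 0 := by linarith
      have := mul_pos Real.pi_pos (neg_pos.2 this); linarith
    unfold halfLineExp
    rw [hset, integrable_indicator_iff measurableSet_Iio, integral_indicator measurableSet_Iio,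
      ← integral_Iic_eq_integral_Iio]
    refine ⟨(integrableOn_exp_mul_complex_Iic hre 0).mono_set Set.Iio_subset_Iic_self, ?_⟩
    rw [integral_exp_mul_complex_Iic hre 0]
    simp

/-- The exponential `ξ ↦ e^{2πi (w₁ ξ₁ + w₂ ξ₂)}` cut off to the quadrant
`ε₁ ξ₁ > 0`, `ε₂ ξ₂ > 0`. -/
noncomputable def quadrantExp (ε : ℝ × ℝ) (w : ℂ × ℂ) (ξ : ℝ × ℝ) : ℂ :=
  halfLineExp ε.1 w.1 ξ.1 * halfLineExp ε.2 w.2 ξ.2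

/-- The indicator function of the quadrant `ε₁ ξ₁ > 0`, `ε₂ ξ₂ > 0`. -/
noncomputable def quadrantInd (ε : ℝ × ℝ) : ℝ × ℝ → ℂ :=
  quadrantExp ε 0

theorem quadrantExp_of_pos {ε : ℝ × ℝ} {ξ : ℝ × ℝ} (h1 : 0 < ε.1 * ξ.1) (h2 : 0 < ε.2 * ξ.2)
    (w : ℂ × ℂ) :
    quadrantExp ε w ξ = Complex.exp (2 * Real.pi * Complex.I * (w.1 * ξ.1 + w.2 * ξ.2)) := by
  rw [quadrantExp, halfLineExp, halfLineExp, Set.indicator_of_mem (by exact h1),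
    Set.indicator_of_mem (by exact h2), ← Complex.exp_add]
  ring_nf

theorem quadrantExp_of_not_pos {ε : ℝ × ℝ} {ξ : ℝ × ℝ} (h : ¬ (0 < ε.1 * ξ.1 ∧ 0 < ε.2 * ξ.2))
    (w : ℂ × ℂ) : quadrantExp ε w ξ = 0 := by
  rw [quadrantExp, halfLineExp, halfLineExp]
  by_cases h1 : 0 < ε.1 * ξ.1
  · rw [Set.indicator_of_notMem (s := {x : ℝ | 0 < ε.2 * x}) (fun h2 => h ⟨h1, h2⟩), mul_zero]
  · rw [Set.indicator_of_notMem (s := {x : ℝ | 0 < ε.1 * x}) (fun h2 => h1 h2), zero_mul]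

theorem quadrantInd_eq (ε ξ : ℝ × ℝ) :
    quadrantInd ε ξ = if 0 < ε.1 * ξ.1 ∧ 0 < ε.2 * ξ.2 then 1 else 0 := by
  split_ifs with h
  · simp [quadrantInd, quadrantExp_of_pos h.1 h.2]
  · exact quadrantExp_of_not_pos h 0

theorem measurable_halfLineExp (s : ℝ) (a : ℂ) : Measurable (halfLineExp s a) :=
  (by fun_prop : Measurable fun x : ℝ => Complex.exp (2 * Real.pi * Complex.I * a * x)).indicator
    (measurableSet_lt measurable_const (by fun_prop))

theorem measurable_quadrantExp (ε : ℝ × ℝ) (w : ℂ × ℂ) : Measurable (quadrantExp ε w) :=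
  ((measurable_halfLineExp _ _).comp measurable_fst).mul
    ((measurable_halfLineExp _ _).comp measurable_snd)

theorem quadrantExp_mul (ε : ℝ × ℝ) (v w : ℂ × ℂ) (ξ : ℝ × ℝ) :
    quadrantExp ε v ξ * quadrantExp ε w ξ = quadrantExp ε (v + w) ξ := by
  by_cases h : 0 < ε.1 * ξ.1 ∧ 0 < ε.2 * ξ.2
  · simp only [quadrantExp_of_pos h.1 h.2, ← Complex.exp_add, Prod.fst_add, Prod.snd_add]
    ring_nf
  · simp [quadrantExp_of_not_pos h]

theorem norm_quadrantExp_le_one (t : Tuboid) {w : ℂ × ℂ}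
    (h1 : 0 ≤ t.eps.1 * w.1.im) (h2 : 0 ≤ t.eps.2 * w.2.im) (ξ : ℝ × ℝ) :
    ‖quadrantExp t.eps w ξ‖ ≤ 1 := by
  by_cases h : 0 < t.eps.1 * ξ.1 ∧ 0 < t.eps.2 * ξ.2
  · rw [quadrantExp_of_pos h.1 h.2, Complex.norm_exp, Real.exp_le_one_iff, two_pi_I_mul_re]
    have e1 : t.eps.1 * t.eps.1 = 1 := by rcases t.eps_fst_eq with e | e <;> rw [e] <;> norm_num
    have e2 : t.eps.2 * t.eps.2 = 1 := by rcases t.eps_snd_eq with e | e <;> rw [e] <;> norm_num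
    have k : 0 ≤ (w.1 * ξ.1 + w.2 * ξ.2).im := by
      simp only [Complex.add_im, Complex.im_mul_ofReal]
      have a1 := mul_nonneg h1 h.1.le
      have a2 := mul_nonneg h2 h.2.le
      have b1 : t.eps.1 * w.1.im * (t.eps.1 * ξ.1) = w.1.im * ξ.1 := by
        linear_combination (w.1.im * ξ.1) * e1
      have b2 : t.eps.2 * w.2.im * (t.eps.2 * ξ.2) = w.2.im * ξ.2 := by
        linear_combination (w.2.im * ξ.2) * e2
      linarith
    have := mul_nonneg Real.pi_pos.le k
    linarith
  · simp [quadrantExp_of_not_pos h]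

theorem integrable_quadrantExp (t : Tuboid) {w : ℂ × ℂ} (hw : w ∈ tube t.eps) :
    Integrable (quadrantExp t.eps w) :=
  (halfLineExp_integrable_and_integral t.eps_fst_eq hw.1).1.mul_prod
    (halfLineExp_integrable_and_integral t.eps_snd_eq hw.2).1

theorem integral_quadrantExp (t : Tuboid) {w : ℂ × ℂ} (hw : w ∈ tube t.eps) :
    ∫ ξ, quadrantExp t.eps w ξ = -t.sign / (4 * (Real.pi : ℂ) ^ 2) * (w.1 * w.2)⁻¹ := by
  have h := integral_prod_mul (μ := (volume : Measure ℝ)) (ν := (volume : Measure ℝ))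
    (halfLineExp t.eps.1 w.1) (halfLineExp t.eps.2 w.2)
  rw [(halfLineExp_integrable_and_integral t.eps_fst_eq hw.1).2,
    (halfLineExp_integrable_and_integral t.eps_snd_eq hw.2).2] at h
  refine h.trans ?_
  rw [t.sign_eq_eps_mul, div_mul_div_comm, mul_inv, div_eq_mul_inv, div_eq_mul_inv]
  have : (2 * (Real.pi : ℂ) * Complex.I * w.1 * (2 * Real.pi * Complex.I * w.2))
      = -(4 * (Real.pi : ℂ) ^ 2) * (w.1 * w.2) := by
    linear_combination (4 * (Real.pi : ℂ) ^ 2 * w.1 * w.2) * Complex.I_sq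
  rw [this, mul_inv, mul_inv, inv_neg]
  ring

/-- Square integrability follows from integrability, as `|e^{2πi w·ξ}|² = |e^{2πi (2w)·ξ}|`. -/
theorem memLp_quadrantExp (t : Tuboid) {w : ℂ × ℂ} (hw : w ∈ tube t.eps) :
    MemLp (quadrantExp t.eps w) 2 := by
  rw [memLp_two_iff_integrable_sq_norm (measurable_quadrantExp _ _).aestronglyMeasurable]
  have h2 : w + w ∈ tube t.eps := by
    refine ⟨?_, ?_⟩ <;> simp only [Prod.fst_add, Prod.snd_add, Complex.add_im]
    · linarith [hw.1]
    · linarith [hw.2]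
  refine (integrable_quadrantExp t h2).norm.congr (Eventually.of_forall fun ξ => ?_)
  simp only [← quadrantExp_mul, norm_mul, sq]

/-- The Cauchy kernel `1 / ((l - λ) (m - μ))`. -/
noncomputable def cauchyKernel (w : ℂ × ℂ) (p : ℝ × ℝ) : ℂ :=
  ((p.1 - w.1) * (p.2 - w.2))⁻¹

theorem exp_mul_quadrantExp (ε : ℝ × ℝ) (w : ℂ × ℂ) (p ξ : ℝ × ℝ) :
    Complex.exp (2 * Real.pi * Complex.I * (p.1 * ξ.1 + p.2 * ξ.2)) * quadrantExp ε w ξ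
      = quadrantExp ε (p.1 + w.1, p.2 + w.2) ξ := by
  by_cases h : 0 < ε.1 * ξ.1 ∧ 0 < ε.2 * ξ.2
  · simp only [quadrantExp_of_pos h.1 h.2, ← Complex.exp_add]
    ring_nf
  · simp [quadrantExp_of_not_pos h]

theorem star_quadrantExp (ε : ℝ × ℝ) (w : ℂ × ℂ) (ξ : ℝ × ℝ) :
    (starRingEnd ℂ) (quadrantExp ε w ξ)
      = quadrantExp ε (-(starRingEnd ℂ) w.1, -(starRingEnd ℂ) w.2) ξ := by
  by_cases h : 0 < ε.1 * ξ.1 ∧ 0 < ε.2 * ξ.2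
  · simp only [quadrantExp_of_pos h.1 h.2, ← Complex.exp_conj]
    simp [Complex.conj_ofReal, Complex.conj_ofNat]
    ring_nf
  · simp [quadrantExp_of_not_pos h]

theorem star_mem_tube {ε : ℝ × ℝ} {w : ℂ × ℂ} (hw : w ∈ tube ε) :
    (-(starRingEnd ℂ) w.1, -(starRingEnd ℂ) w.2) ∈ tube ε := by
  simpa [tube] using hw

theorem ofReal_add_mem_tube {ε : ℝ × ℝ} {w : ℂ × ℂ} (hw : w ∈ tube ε) (p : ℝ × ℝ) :
    ((p.1 : ℂ) + w.1, (p.2 : ℂ) + w.2) ∈ tube ε := by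
  simpa [tube] using hw

/-- The complex conjugate of the Cauchy kernel, which is what enters the inner product, is up to a
constant the inverse Fourier transform of an exponential on the quadrant of the tube. -/
theorem planeFourierInv_quadrantExp (t : Tuboid) {w : ℂ × ℂ} (hw : w ∈ tube t.eps) :
    planeFourierInv ((memLp_quadrantExp t (star_mem_tube hw)).toLp _) =ᵐ[volume]
      fun p => (starRingEnd ℂ) (-t.sign / (4 * (Real.pi : ℂ) ^ 2) * cauchyKernel w p) := by
  refine (planeFourierInv_toLp_ae_eq (integrable_quadrantExp t (star_mem_tube hw)) _).trans
    (Eventually.of_forall fun p => ?_)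
  simp only [exp_mul_quadrantExp]
  rw [integral_quadrantExp t (ofReal_add_mem_tube (star_mem_tube hw) p)]
  have hs : (starRingEnd ℂ) t.sign = t.sign := by cases t <;> simp [Tuboid.sign]
  simp [cauchyKernel, hs, Complex.conj_ofReal, Complex.conj_ofNat, sub_eq_add_neg]

/-- The Cauchy integral `± (4π²)⁻¹ ∫ g(l, m) / ((l - λ) (m - μ))` of a function on `ℝ²`, with the
sign that makes it reproduce the Hardy space of the tube of `t`. -/
noncomputable def tubeCauchy (t : Tuboid) (g : ℝ × ℝ → ℂ) (w : ℂ × ℂ) : ℂ :=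
  -t.sign / (4 * (Real.pi : ℂ) ^ 2) * ∫ p, g p * cauchyKernel w p

theorem memLp_cauchyKernel (t : Tuboid) {w : ℂ × ℂ} (hw : w ∈ tube t.eps) :
    MemLp (cauchyKernel w) 2 := by
  have h := (memLp_congr_ae (planeFourierInv_quadrantExp t hw)).1 (Lp.memLp _)
  have h2 : MemLp (fun p => -t.sign / (4 * (Real.pi : ℂ) ^ 2) * cauchyKernel w p) 2 := by
    refine (memLp_congr_ae (Eventually.of_forall fun p => ?_)).1 h.star
    simp only [Pi.star_apply, ← starRingEnd_apply, RingHomCompTriple.comp_apply, RingHom.id_apply]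
  have hc : -t.sign / (4 * (Real.pi : ℂ) ^ 2) ≠ 0 := by
    have : t.sign ≠ 0 := by cases t <;> simp [Tuboid.sign]
    have := Real.pi_ne_zero
    simp [*]
  have h3 := h2.const_mul (-t.sign / (4 * (Real.pi : ℂ) ^ 2))⁻¹
  refine (memLp_congr_ae (Eventually.of_forall fun p => ?_)).1 h3
  exact inv_mul_cancel_left₀ hc _

theorem integrable_mul_cauchyKernel (t : Tuboid) {w : ℂ × ℂ} (hw : w ∈ tube t.eps)
    {g : ℝ × ℝ → ℂ} (hg : MemLp g 2) : Integrable fun p => g p * cauchyKernel w p :=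
  hg.integrable_mul (memLp_cauchyKernel t hw)

/-- By Plancherel, the Cauchy integral is the Fourier-Laplace integral over one quadrant. -/
theorem tubeCauchy_eq_integral_quadrantExp (t : Tuboid) {w : ℂ × ℂ} (hw : w ∈ tube t.eps)
    (g : Lp ℂ 2 (volume : Measure (ℝ × ℝ))) :
    tubeCauchy t g w = ∫ ξ, quadrantExp t.eps w ξ * planeFourierInv.symm g ξ := by
  set ψ := (memLp_quadrantExp t (star_mem_tube hw)).toLp _ with hψ
  have key : inner ℂ (planeFourierInv ψ) g = inner ℂ ψ (planeFourierInv.symm g) := by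
    conv_lhs => rw [← planeFourierInv.apply_symm_apply g]
    exact planeFourierInv.inner_map_map _ _
  rw [L2.inner_def, L2.inner_def] at key
  rw [tubeCauchy, ← integral_const_mul]
  convert key using 1
  · refine integral_congr_ae ?_
    filter_upwards [planeFourierInv_quadrantExp t hw] with p hp
    rw [hp, RCLike.inner_apply, RingHomCompTriple.comp_apply, RingHom.id_apply]
    ring
  · refine integral_congr_ae ?_
    filter_upwards [(memLp_quadrantExp t (star_mem_tube hw)).coeFn_toLp] with ξ hξ
    rw [hψ, hξ, RCLike.inner_apply, star_quadrantExp]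
    simp [mul_comm]

/-! ### The Hardy projections of `L²(ℝ × ℝ)` -/

theorem lintegral_enorm_sq_eq_enorm_Lp (u : Lp ℂ 2 (volume : Measure (ℝ × ℝ))) :
    ∫⁻ p, ‖u p‖ₑ ^ 2 = ‖u‖ₑ ^ 2 := by
  have := eLpNorm_nnreal_pow_eq_lintegral (μ := (volume : Measure (ℝ × ℝ))) (f := u) (p := 2)
    two_ne_zero
  rw [Lp.enorm_def]
  simpa using this.symm

/-- A unitary operator preserves the `L²` distance of functions given by representatives. -/
theorem lintegral_enorm_sub_sq_unitary
    (V : Lp ℂ 2 (volume : Measure (ℝ × ℝ)) ≃ₗᵢ[ℂ] Lp ℂ 2 (volume : Measure (ℝ × ℝ)))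
    {a b : ℝ × ℝ → ℂ} (ha : MemLp a 2) (hb : MemLp b 2) :
    ∫⁻ p, ‖V (ha.toLp a) p - V (hb.toLp b) p‖ₑ ^ 2 = ∫⁻ p, ‖a p - b p‖ₑ ^ 2 := by
  have e1 : ∫⁻ p, ‖V (ha.toLp a) p - V (hb.toLp b) p‖ₑ ^ 2
      = ∫⁻ p, ‖(V (ha.toLp a - hb.toLp b)) p‖ₑ ^ 2 := by
    refine lintegral_congr_ae ?_
    rw [map_sub]
    filter_upwards [Lp.coeFn_sub (V (ha.toLp a)) (V (hb.toLp b))] with p hp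
    rw [hp, Pi.sub_apply]
  have e2 : ∫⁻ p, ‖a p - b p‖ₑ ^ 2 = ∫⁻ p, ‖(ha.toLp a - hb.toLp b) p‖ₑ ^ 2 := by
    refine lintegral_congr_ae ?_
    filter_upwards [Lp.coeFn_sub (ha.toLp a) (hb.toLp b), ha.coeFn_toLp, hb.coeFn_toLp]
      with p hp h1 h2
    rw [hp, Pi.sub_apply, h1, h2]
  rw [e1, e2, lintegral_enorm_sq_eq_enorm_Lp, lintegral_enorm_sq_eq_enorm_Lp,
    LinearIsometryEquiv.enorm_map]

theorem memLp_quadrantExp_mul (t : Tuboid) {w : ℂ × ℂ} (h1 : 0 ≤ t.eps.1 * w.1.im)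
    (h2 : 0 ≤ t.eps.2 * w.2.im) {h : ℝ × ℝ → ℂ} (hh : MemLp h 2) :
    MemLp (fun ξ => quadrantExp t.eps w ξ * h ξ) 2 := by
  refine hh.of_le ((measurable_quadrantExp _ _).aestronglyMeasurable.mul hh.1)
    (Eventually.of_forall fun ξ => ?_)
  rw [norm_mul]
  exact mul_le_of_le_one_left (norm_nonneg _) (norm_quadrantExp_le_one t h1 h2 ξ)

theorem memLp_quadrantInd_mul (t : Tuboid) {h : ℝ × ℝ → ℂ} (hh : MemLp h 2) :
    MemLp (fun ξ => quadrantInd t.eps ξ * h ξ) 2 :=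
  memLp_quadrantExp_mul t (by simp) (by simp) hh

/-- The orthogonal projection of `L²(ℝ × ℝ)` onto the boundary values of the Hardy space of the
tube of `t`: the Fourier transform is cut off to one quadrant. -/
noncomputable def hardyProj (t : Tuboid) (g : Lp ℂ 2 (volume : Measure (ℝ × ℝ))) :
    Lp ℂ 2 (volume : Measure (ℝ × ℝ)) :=
  planeFourierInv
    ((memLp_quadrantInd_mul t (Lp.memLp (planeFourierInv.symm g))).toLp _)

/-- The four quadrants cover the plane up to the coordinate axes. -/
theorem quadrantInd_sum_ae :
    ∀ᵐ ξ : ℝ × ℝ, quadrantInd Tuboid.plus.eps ξ + quadrantInd Tuboid.minus.eps ξ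
      + quadrantInd Tuboid.right.eps ξ + quadrantInd Tuboid.left.eps ξ = 1 := by
  have h1 : ∀ᵐ ξ : ℝ × ℝ, ξ.1 ≠ 0 :=
    Measure.quasiMeasurePreserving_fst.ae (Measure.ae_ne volume 0)
  have h2 : ∀ᵐ ξ : ℝ × ℝ, ξ.2 ≠ 0 :=
    Measure.quasiMeasurePreserving_snd.ae (Measure.ae_ne volume 0)
  filter_upwards [h1, h2] with ξ k1 k2
  simp only [quadrantInd_eq, Tuboid.eps]
  rcases lt_or_gt_of_ne k1 with k1 | k1 <;> rcases lt_or_gt_of_ne k2 with k2 | k2 <;>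
    simp [k1, k2, not_lt.2 k1.le, not_lt.2 k2.le]

theorem hardyProj_sum (g : Lp ℂ 2 (volume : Measure (ℝ × ℝ))) :
    g = hardyProj .plus g + hardyProj .minus g + hardyProj .right g + hardyProj .left g := by
  simp only [hardyProj, ← map_add]
  rw [← LinearIsometryEquiv.symm_apply_eq]
  simp only [← MemLp.toLp_add]
  refine Lp.ext ?_
  refine EventuallyEq.trans ?_ (MemLp.coeFn_toLp _).symm
  filter_upwards [quadrantInd_sum_ae] with ξ hξ
  simp only [Pi.add_apply, ← add_mul, hξ, one_mul]

theorem quadrantInd_mul_quadrantExp (ε : ℝ × ℝ) (w : ℂ × ℂ) (ξ : ℝ × ℝ) :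
    quadrantExp ε w ξ * quadrantInd ε ξ = quadrantExp ε w ξ := by
  rw [quadrantInd, quadrantExp_mul, add_zero]

theorem tubeCauchy_hardyProj (t : Tuboid) {w : ℂ × ℂ} (hw : w ∈ tube t.eps)
    (g : Lp ℂ 2 (volume : Measure (ℝ × ℝ))) :
    tubeCauchy t (hardyProj t g) w = tubeCauchy t g w := by
  rw [tubeCauchy_eq_integral_quadrantExp t hw, tubeCauchy_eq_integral_quadrantExp t hw]
  refine integral_congr_ae ?_
  rw [hardyProj, LinearIsometryEquiv.symm_apply_apply]
  filter_upwards [(memLp_quadrantInd_mul t (Lp.memLp (planeFourierInv.symm g))).coeFn_toLp]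
    with ξ hξ
  rw [hξ, ← mul_assoc, quadrantInd_mul_quadrantExp]

theorem tubePoint_mem_tube (t : Tuboid) {η : ℝ × ℝ} (h1 : 0 < η.1) (h2 : 0 < η.2) (p : ℝ × ℝ) :
    tubePoint t.eps η p ∈ tube t.eps := by
  have e1 : 0 < t.eps.1 * t.eps.1 := by rcases t.eps_fst_eq with e | e <;> rw [e] <;> norm_num
  have e2 : 0 < t.eps.2 * t.eps.2 := by rcases t.eps_snd_eq with e | e <;> rw [e] <;> norm_num
  refine ⟨?_, ?_⟩ <;> simp only [tubePoint, ← mul_assoc] <;> positivity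

/-- At fixed heights `η` the Cauchy integral is, as a function on `ℝ²`, the inverse Fourier
transform of the damped restriction of the Fourier transform of `g` to the quadrant. -/
theorem tubeCauchy_tubePoint_ae_eq (t : Tuboid) (g : Lp ℂ 2 (volume : Measure (ℝ × ℝ)))
    {η : ℝ × ℝ} (h1 : 0 < η.1) (h2 : 0 < η.2)
    (hm : MemLp (fun ξ => quadrantExp t.eps (tubePoint t.eps η 0) ξ *
      planeFourierInv.symm g ξ) 2) :
    (fun p => tubeCauchy t g (tubePoint t.eps η p)) =ᵐ[volume] planeFourierInv (hm.toLp _) := by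
  have hi : Integrable (fun ξ => quadrantExp t.eps (tubePoint t.eps η 0) ξ *
      planeFourierInv.symm g ξ) :=
    (memLp_quadrantExp t (tubePoint_mem_tube t h1 h2 0)).integrable_mul (Lp.memLp _)
  refine EventuallyEq.trans (Eventually.of_forall fun p => ?_)
    (planeFourierInv_toLp_ae_eq hi hm).symm
  simp only
  rw [tubeCauchy_eq_integral_quadrantExp t (tubePoint_mem_tube t h1 h2 p)]
  refine integral_congr_ae (Eventually.of_forall fun ξ => ?_)
  simp only
  rw [← mul_assoc, exp_mul_quadrantExp]
  congr 2
  ext <;> simp [tubePoint, Complex.ext_iff]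

theorem tubePoint_zero_nonneg (t : Tuboid) {η : ℝ × ℝ} (h1 : 0 < η.1) (h2 : 0 < η.2) :
    0 ≤ t.eps.1 * (tubePoint t.eps η 0).1.im ∧ 0 ≤ t.eps.2 * (tubePoint t.eps η 0).2.im :=
  ⟨(tubePoint_mem_tube t h1 h2 0).1.le, (tubePoint_mem_tube t h1 h2 0).2.le⟩

theorem lintegral_tubeCauchy_le (t : Tuboid) (g : Lp ℂ 2 (volume : Measure (ℝ × ℝ)))
    {η : ℝ × ℝ} (h1 : 0 < η.1) (h2 : 0 < η.2) :
    ∫⁻ p, ‖tubeCauchy t g (tubePoint t.eps η p)‖ₑ ^ 2 ≤ ‖g‖ₑ ^ 2 := by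
  obtain ⟨n1, n2⟩ := tubePoint_zero_nonneg t h1 h2
  have hm := memLp_quadrantExp_mul t n1 n2 (Lp.memLp (planeFourierInv.symm g))
  calc ∫⁻ p, ‖tubeCauchy t g (tubePoint t.eps η p)‖ₑ ^ 2
      = ∫⁻ p, ‖planeFourierInv (hm.toLp _) p‖ₑ ^ 2 := by
        refine lintegral_congr_ae ?_
        filter_upwards [tubeCauchy_tubePoint_ae_eq t g h1 h2 hm] with p hp
        rw [hp]
    _ = ∫⁻ ξ, ‖hm.toLp _ ξ‖ₑ ^ 2 := by
        rw [lintegral_enorm_sq_eq_enorm_Lp, lintegral_enorm_sq_eq_enorm_Lp,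
          LinearIsometryEquiv.enorm_map]
    _ ≤ ∫⁻ ξ, ‖planeFourierInv.symm g ξ‖ₑ ^ 2 := by
        refine lintegral_mono_ae ?_
        filter_upwards [hm.coeFn_toLp] with ξ hξ
        rw [hξ]
        gcongr
        rw [enorm_le_iff_norm_le, norm_mul]
        exact mul_le_of_le_one_left (norm_nonneg _) (norm_quadrantExp_le_one t n1 n2 ξ)
    _ = ‖g‖ₑ ^ 2 := by
        rw [lintegral_enorm_sq_eq_enorm_Lp, LinearIsometryEquiv.enorm_map]

theorem tendsto_quadrantExp_tubePoint (ε ξ : ℝ × ℝ) :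
    Tendsto (fun η : ℝ × ℝ => quadrantExp ε (tubePoint ε η 0) ξ)
      (𝓝[{η : ℝ × ℝ | 0 < η.1 ∧ 0 < η.2}] 0) (𝓝 (quadrantInd ε ξ)) := by
  by_cases h : 0 < ε.1 * ξ.1 ∧ 0 < ε.2 * ξ.2
  · simp only [quadrantInd, quadrantExp_of_pos h.1 h.2]
    refine Tendsto.mono_left ?_ nhdsWithin_le_nhds
    have : Continuous fun η : ℝ × ℝ => Complex.exp (2 * Real.pi * Complex.I *
        ((tubePoint ε η 0).1 * ξ.1 + (tubePoint ε η 0).2 * ξ.2)) := by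
      have : ∀ η : ℝ × ℝ, tubePoint ε η 0
          = (((ε.1 * η.1 : ℝ) : ℂ) * Complex.I, ((ε.2 * η.2 : ℝ) : ℂ) * Complex.I) := by
        intro η
        ext <;> simp [tubePoint, Complex.ext_iff]
      simp only [this]
      fun_prop
    have h0 := this.tendsto 0
    convert h0 using 3
    simp [tubePoint, Complex.ext_iff]
  · simp only [quadrantInd, quadrantExp_of_not_pos h]
    exact tendsto_const_nhds

/-- The Cauchy integral has the Hardy projection as its boundary value in `L²`: dominated
convergence on the Fourier side. -/
theorem tendsto_lintegral_tubeCauchy_sub_hardyProj (t : Tuboid)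
    (g : Lp ℂ 2 (volume : Measure (ℝ × ℝ))) :
    Tendsto (fun η : ℝ × ℝ => ∫⁻ p,
        ‖tubeCauchy t g (tubePoint t.eps η p) - hardyProj t g p‖ₑ ^ 2)
      (𝓝[{η : ℝ × ℝ | 0 < η.1 ∧ 0 < η.2}] 0) (𝓝 0) := by
  set h := planeFourierInv.symm g with hh
  have key : Tendsto (fun η : ℝ × ℝ => ∫⁻ ξ,
        ‖quadrantExp t.eps (tubePoint t.eps η 0) ξ * h ξ - quadrantInd t.eps ξ * h ξ‖ₑ ^ 2)
      (𝓝[{η : ℝ × ℝ | 0 < η.1 ∧ 0 < η.2}] 0) (𝓝 (∫⁻ _ : ℝ × ℝ, 0)) := by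
    refine tendsto_lintegral_filter_of_dominated_convergence
      (fun ξ => (2 * ‖h ξ‖ₑ) ^ 2) ?_ ?_ ?_ ?_
    · refine Eventually.of_forall fun η => ?_
      have h1 := (measurable_quadrantExp t.eps (tubePoint t.eps η 0))
      have h2 := (measurable_quadrantExp t.eps 0)
      have h3 := (Lp.stronglyMeasurable h).measurable
      exact (((h1.mul h3).sub (h2.mul h3)).enorm).pow_const 2
    · filter_upwards [self_mem_nhdsWithin] with η hη
      refine Eventually.of_forall fun ξ => ?_
      obtain ⟨n1, n2⟩ := tubePoint_zero_nonneg t hη.1 hη.2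
      gcongr
      refine (enorm_sub_le).trans ?_
      rw [two_mul, enorm_mul, enorm_mul]
      have b1 : ‖quadrantExp t.eps (tubePoint t.eps η 0) ξ‖ₑ ≤ 1 := by
        rw [← enorm_one (G := ℂ), enorm_le_iff_norm_le, norm_one]
        exact norm_quadrantExp_le_one t n1 n2 ξ
      have b2 : ‖quadrantInd t.eps ξ‖ₑ ≤ 1 := by
        rw [← enorm_one (G := ℂ), enorm_le_iff_norm_le, norm_one]
        exact norm_quadrantExp_le_one t (by simp) (by simp) ξ
      exact add_le_add (mul_le_of_le_one_left' b1) (mul_le_of_le_one_left' b2)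
    · simp only [mul_pow]
      rw [lintegral_const_mul' _ _ (by norm_num), lintegral_enorm_sq_eq_enorm_Lp]
      exact ENNReal.mul_ne_top (by norm_num) (by simp)
    · refine Eventually.of_forall fun ξ => ?_
      have h1 := ((tendsto_quadrantExp_tubePoint t.eps ξ).mul_const (h ξ)).sub_const
        (quadrantInd t.eps ξ * h ξ)
      rw [sub_self] at h1
      simpa using ENNReal.Tendsto.pow (n := 2) h1.enorm
  rw [lintegral_zero] at key
  refine key.congr' ?_
  filter_upwards [self_mem_nhdsWithin] with η hη
  obtain ⟨n1, n2⟩ := tubePoint_zero_nonneg t hη.1 hη.2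
  have hm := memLp_quadrantExp_mul t n1 n2 (Lp.memLp h)
  rw [← lintegral_enorm_sub_sq_unitary planeFourierInv hm (memLp_quadrantInd_mul t (Lp.memLp h))]
  refine lintegral_congr_ae ?_
  filter_upwards [tubeCauchy_tubePoint_ae_eq t g hη.1 hη.2 hm] with p hp
  rw [hp]
  rfl

/-! ### Holomorphy of the Cauchy integral -/

section Holomorphy

open scoped BoundedContinuousFunction

theorem ofReal_sub_ne_zero {a : ℂ} (ha : a.im ≠ 0) (x : ℝ) : (x : ℂ) - a ≠ 0 := by
  intro h
  apply ha
  have := congrArg Complex.im h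
  simpa using this

/-- The function `x ↦ 1 / (x - a)` as a bounded continuous function on `ℝ`, for `a` not real. -/
noncomputable def resolventBCF {a : ℂ} (ha : a.im ≠ 0) : ℝ →ᵇ ℂ :=
  BoundedContinuousFunction.ofNormedAddCommGroup (fun x : ℝ => ((x : ℂ) - a)⁻¹)
    (Continuous.inv₀ (by fun_prop) (ofReal_sub_ne_zero ha)) |a.im|⁻¹ fun x => by
      rw [norm_inv]
      refine inv_anti₀ (abs_pos.2 ha) ?_
      simpa using Complex.abs_im_le_norm ((x : ℂ) - a)

theorem inverse_apply_of_isUnit {X : Type*} [TopologicalSpace X] {u : X →ᵇ ℂ} (hu : IsUnit u)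
    (x : X) : Ring.inverse u x = (u x)⁻¹ := by
  have := congrArg (fun b : X →ᵇ ℂ => b x) (Ring.inverse_mul_cancel u hu)
  simp only [BoundedContinuousFunction.mul_apply, BoundedContinuousFunction.coe_one,
    Pi.one_apply] at this
  exact eq_inv_of_mul_eq_one_left this

/-- Integration against an integrable function, as a functional on bounded continuous functions. -/
noncomputable def integralAgainst {k : ℝ × ℝ → ℂ} (hk : Integrable k) :
    ((ℝ × ℝ) →ᵇ ℂ) →L[ℂ] ℂ :=
  LinearMap.mkContinuous
    { toFun := fun b => ∫ p, k p * b p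
      map_add' := fun b c => by
        rw [← integral_add]
        · simp [mul_add]
        · exact hk.mul_bdd (c := ‖b‖) b.continuous.aestronglyMeasurable
            (Eventually.of_forall b.norm_coe_le_norm)
        · exact hk.mul_bdd (c := ‖c‖) c.continuous.aestronglyMeasurable
            (Eventually.of_forall c.norm_coe_le_norm)
      map_smul' := fun r b => by
        simp only [RingHom.id_apply, smul_eq_mul, ← integral_const_mul]
        congr 1
        ext p
        simp
        ring }
    (∫ p, ‖k p‖) fun b => by
      refine (norm_integral_le_integral_norm _).trans ?_
      rw [← integral_mul_const]
      refine integral_mono_of_nonneg (Eventually.of_forall fun _ => norm_nonneg _)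
        (hk.norm.mul_const _) (Eventually.of_forall fun p => ?_)
      simp only [norm_mul]
      gcongr
      exact b.norm_coe_le_norm p

/-- For a bounded continuous function `a`, the inverse of `1 - (v - c) a` in the Banach algebra of
bounded continuous functions depends analytically on `v` near `c`. -/
theorem analyticAt_inverse_one_sub_smul {X : Type*} [TopologicalSpace X] (a : X →ᵇ ℂ)
    {φ : ℂ × ℂ → ℂ} {w₀ : ℂ × ℂ} (hφ : AnalyticAt ℂ φ w₀) :
    AnalyticAt ℂ (fun w => Ring.inverse (1 - (φ w - φ w₀) • a)) w₀ ∧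
      ∀ᶠ w in 𝓝 w₀, IsUnit (1 - (φ w - φ w₀) • a) := by
  have h1 : AnalyticAt ℂ (fun w => (1 : X →ᵇ ℂ) - (φ w - φ w₀) • a) w₀ :=
    analyticAt_const.sub ((hφ.sub analyticAt_const).smul analyticAt_const)
  have h0 : (1 : X →ᵇ ℂ) - (φ w₀ - φ w₀) • a = ((1 : (X →ᵇ ℂ)ˣ) : X →ᵇ ℂ) := by simp
  refine ⟨?_, ?_⟩
  · refine AnalyticAt.fun_comp (g := Ring.inverse) ?_ h1
    rw [h0]
    exact analyticAt_inverse _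
  · refine h1.continuousAt.eventually (p := IsUnit) ?_
    simp only [h0]
    exact Units.nhds 1

/-- Near `w₀` the Cauchy kernel is the kernel at `w₀` times resolvents in the Banach algebra of
bounded continuous functions, which are analytic in `w`. -/
theorem analyticAt_tubeCauchy (t : Tuboid) {g : ℝ × ℝ → ℂ} (hg : MemLp g 2) {w₀ : ℂ × ℂ}
    (hw : w₀ ∈ tube t.eps) : AnalyticAt ℂ (tubeCauchy t g) w₀ := by
  have i1 : w₀.1.im ≠ 0 := fun h => by simpa [h] using hw.1
  have i2 : w₀.2.im ≠ 0 := fun h => by simpa [h] using hw.2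
  set a₁ := (resolventBCF i1).compContinuous ⟨(Prod.fst : ℝ × ℝ → ℝ), continuous_fst⟩ with ha₁
  set a₂ := (resolventBCF i2).compContinuous ⟨(Prod.snd : ℝ × ℝ → ℝ), continuous_snd⟩ with ha₂
  obtain ⟨b1, u1⟩ := analyticAt_inverse_one_sub_smul a₁ (analyticAt_fst (𝕜 := ℂ) (p := w₀))
  obtain ⟨b2, u2⟩ := analyticAt_inverse_one_sub_smul a₂ (analyticAt_snd (𝕜 := ℂ) (p := w₀))
  have hk := integrable_mul_cauchyKernel t hw hg
  have hL := ((integralAgainst hk).analyticAt _).fun_comp (b1.mul b2)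
  refine (analyticAt_const.mul hL).congr (f := fun w =>
    -t.sign / (4 * (Real.pi : ℂ) ^ 2) * integralAgainst hk
      (Ring.inverse (1 - (w.1 - w₀.1) • a₁) * Ring.inverse (1 - (w.2 - w₀.2) • a₂))) ?_
  filter_upwards [u1, u2] with w h1 h2
  rw [tubeCauchy]
  congr 1
  refine integral_congr_ae (Eventually.of_forall fun p => ?_)
  have e1 : ∀ (x : ℝ) (a b : ℂ), a.im ≠ 0 →
      (x - a)⁻¹ * (1 - (b - a) * (x - a)⁻¹)⁻¹ = ((x : ℂ) - b)⁻¹ := by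
    intro x a b ha
    have := ofReal_sub_ne_zero ha x
    rw [← mul_inv]
    congr 1
    field_simp
    ring
  simp only [BoundedContinuousFunction.mul_apply, inverse_apply_of_isUnit h1,
    inverse_apply_of_isUnit h2, cauchyKernel, mul_inv]
  rw [mul_assoc]
  congr 1
  rw [← e1 p.1 w₀.1 w.1 i1, ← e1 p.2 w₀.2 w.2 i2]
  simp only [ha₁, ha₂, BoundedContinuousFunction.coe_sub, BoundedContinuousFunction.coe_one,
    BoundedContinuousFunction.coe_smul, Pi.sub_apply, Pi.one_apply, smul_eq_mul,
    BoundedContinuousFunction.compContinuous_apply, ContinuousMap.coe_mk, resolventBCF,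
    BoundedContinuousFunction.coe_ofNormedAddCommGroup]
  ring

end Holomorphy

/-! ### Geometry of the quadric -/

/-- The inverse `z ↦ ((z₂ + 1) / (z₀ + z₁), (z₂ - 1) / (z₀ + z₁))` of the parametrization
`quadricParam` of the quadric off `z₀ + z₁ = 0`. -/
noncomputable def quadricCoord {K : Type*} [Field K] (z : Fin 3 → K) : K × K :=
  ((z 2 + 1) / (z 0 + z 1), (z 2 - 1) / (z 0 + z 1))

section Field

variable {K : Type*} [Field K]

theorem quadricCoord_quadricParam [CharZero K] {l m : K} (h : l ≠ m) :
    quadricCoord (quadricParam l m) = (l, m) := by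
  have h' : l - m ≠ 0 := sub_ne_zero.2 h
  have e : (1 + l * m) / (l - m) + (1 - l * m) / (l - m) = 2 / (l - m) := by
    field_simp; ring
  ext <;> simp only [quadricCoord, quadricParam, Matrix.cons_val_zero, Matrix.cons_val_one,
    Matrix.cons_val, e] <;> field_simp <;> ring

theorem quadricCoord_sub {z : Fin 3 → K} : (quadricCoord z).1 - (quadricCoord z).2
    = 2 / (z 0 + z 1) := by
  simp only [quadricCoord]
  ring

theorem quadricCoord_fst_ne_snd [CharZero K] {z : Fin 3 → K} (h : z 0 + z 1 ≠ 0) :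
    (quadricCoord z).1 ≠ (quadricCoord z).2 := by
  rw [← sub_ne_zero, quadricCoord_sub]
  exact div_ne_zero two_ne_zero h

theorem quadricParam_quadricCoord [CharZero K] {z : Fin 3 → K} (hz : z ∈ quadric K)
    (h : z 0 + z 1 ≠ 0) : quadricParam (quadricCoord z).1 (quadricCoord z).2 = z := by
  have hq : z 0 * z 0 - z 1 * z 1 - z 2 * z 2 = -1 := hz
  have hd := quadricCoord_sub (z := z)
  have hp : (quadricCoord z).1 * (quadricCoord z).2 = (z 0 - z 1) / (z 0 + z 1) := by
    simp only [quadricCoord]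
    field_simp
    linear_combination -hq
  have hs : (quadricCoord z).1 + (quadricCoord z).2 = 2 * z 2 / (z 0 + z 1) := by
    simp only [quadricCoord]
    ring
  ext i
  fin_cases i <;> simp [quadricParam, hd, hp, hs] <;> field_simp <;> ring

theorem mform_quadricParam {l m : K} (h : l ≠ m) :
    mform (quadricParam l m) (quadricParam l m) = -1 := by
  have h' : l - m ≠ 0 := sub_ne_zero.2 h
  simp only [mform, quadricParam, Matrix.cons_val_zero, Matrix.cons_val_one, Matrix.cons_val]
  field_simp
  ring

/-- The basic factorization of `(x - z)²` in the coordinates `(l, m)`. -/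
theorem mform_quadricParam_sub {l m l' m' : K} (h : l ≠ m) (h' : l' ≠ m') :
    mform (quadricParam l m - quadricParam l' m') (quadricParam l m - quadricParam l' m')
      = -4 * ((l - l') * (m - m')) / ((l - m) * (l' - m')) := by
  have k : l - m ≠ 0 := sub_ne_zero.2 h
  have k' : l' - m' ≠ 0 := sub_ne_zero.2 h'
  simp only [mform, quadricParam, Matrix.cons_val_zero, Matrix.cons_val_one, Matrix.cons_val,
    Pi.sub_apply]
  field_simp
  ring

end Field

theorem toComplex_quadricParam (l m : ℝ) :
    toComplex (quadricParam l m) = quadricParam (l : ℂ) (m : ℂ) := by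
  ext i
  fin_cases i <;> simp [toComplex, quadricParam]

/-- The sections `z₀ + z₁ = 0` of the quadric miss the tuboids. -/
theorem add_ne_zero_of_mform_imPart_ne_zero {z : Fin 3 → ℂ} (hz : z ∈ quadric ℂ)
    (hy : mform (imPart z) (imPart z) ≠ 0) : z 0 + z 1 ≠ 0 := by
  intro h
  have hq : z 0 * z 0 - z 1 * z 1 - z 2 * z 2 = -1 := hz
  have h2 : (z 2 - 1) * (z 2 + 1) = 0 := by linear_combination (z 0 - z 1) * h - hq
  have h2im : (z 2).im = 0 := by
    rcases mul_eq_zero.1 h2 with h3 | h3 <;> simpa using congrArg Complex.im h3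
  have him : (z 0).im + (z 1).im = 0 := by simpa using congrArg Complex.im h
  apply hy
  simp only [mform, imPart, h2im]
  linear_combination ((z 0).im - (z 1).im) * him

theorem mform_imPart_quadricParam {l m : ℂ} (h : l ≠ m) :
    mform (imPart (quadricParam l m)) (imPart (quadricParam l m))
      = -4 * (l.im * m.im) / Complex.normSq (l - m) := by
  have hn : Complex.normSq (l - m) ≠ 0 := (Complex.normSq_pos.2 (sub_ne_zero.2 h)).ne'
  simp only [mform, imPart, quadricParam, Matrix.cons_val_zero, Matrix.cons_val_one,
    Matrix.cons_val, Complex.div_im]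
  field_simp
  simp only [Complex.normSq_apply, Complex.sub_re, Complex.sub_im, Complex.add_re, Complex.add_im,
    Complex.mul_re, Complex.mul_im, Complex.one_re, Complex.one_im]
  ring

theorem imPart_quadricParam_add {l m : ℂ} (h : l ≠ m) :
    imPart (quadricParam l m) 0 + imPart (quadricParam l m) 1
      = -2 * (l.im - m.im) / Complex.normSq (l - m) := by
  have hn : Complex.normSq (l - m) ≠ 0 := (Complex.normSq_pos.2 (sub_ne_zero.2 h)).ne'
  simp only [imPart, quadricParam, Matrix.cons_val_zero, Matrix.cons_val_one, Complex.div_im]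
  field_simp
  simp only [Complex.sub_re, Complex.sub_im, Complex.add_re, Complex.add_im,
    Complex.mul_re, Complex.mul_im, Complex.one_re, Complex.one_im]
  ring

theorem det_quadricParam {l m : ℂ} (h : l ≠ m) :
    Matrix.det (Matrix.of ![![1, 0, 0], rePart (quadricParam l m), imPart (quadricParam l m)])
      = (l.im * (1 + Complex.normSq m) + m.im * (1 + Complex.normSq l))
        / Complex.normSq (l - m) := by
  have hn : Complex.normSq (l - m) ≠ 0 := (Complex.normSq_pos.2 (sub_ne_zero.2 h)).ne'
  rw [Matrix.det_fin_three]
  simp only [Matrix.of_apply, rePart, imPart, quadricParam, Matrix.cons_val_zero,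
    Matrix.cons_val_one, Matrix.cons_val, Complex.div_im, Complex.div_re]
  field_simp
  simp only [Complex.normSq_apply, Complex.sub_re, Complex.sub_im, Complex.add_re, Complex.add_im,
    Complex.mul_re, Complex.mul_im, Complex.one_re, Complex.one_im]
  ring

theorem Tuboid.mem_quadric {t : Tuboid} {z : Fin 3 → ℂ} (hz : z ∈ t.domain) : z ∈ quadric ℂ := by
  cases t <;> exact hz.1

theorem Tuboid.add_ne_zero {t : Tuboid} {z : Fin 3 → ℂ} (hz : z ∈ t.domain) : z 0 + z 1 ≠ 0 := by
  refine add_ne_zero_of_mform_imPart_ne_zero (t.mem_quadric hz) ?_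
  cases t
  · exact hz.2.1.ne'
  · exact hz.2.1.ne'
  · exact hz.2.1.ne
  · exact hz.2.1.ne

theorem quadricParam_mem_domain_imp {t : Tuboid} {l m : ℂ} (h : l ≠ m)
    (hz : quadricParam l m ∈ t.domain) : (l, m) ∈ tube t.eps := by
  have hn : 0 < Complex.normSq (l - m) := Complex.normSq_pos.2 (sub_ne_zero.2 h)
  have h1 := mform_imPart_quadricParam h
  have h2 := imPart_quadricParam_add h
  have he : (![1, 0, 0] : Fin 3 → ℝ) ∈ futureCone := by simp [futureCone, mform]
  have hl := Complex.normSq_nonneg l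
  have hm := Complex.normSq_nonneg m
  -- In a chiral tuboid `Im l` and `Im m` have the same sign, and the determinant tells which.
  cases t
  · obtain ⟨-, hy, hy0⟩ := hz
    have a1 : 0 < -4 * (l.im * m.im) := by rw [h1] at hy; exact (div_pos_iff_of_pos_right hn).1 hy
    have a2 : 0 < imPart (quadricParam l m) 0 + imPart (quadricParam l m) 1 := by
      simp only [mform] at hy
      nlinarith [sq_nonneg (imPart (quadricParam l m) 2)]
    rw [h2] at a2
    have a3 := (div_pos_iff_of_pos_right hn).1 a2
    simp only [tube, Tuboid.eps, Set.mem_ofPred_eq]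
    constructor <;> nlinarith
  · obtain ⟨-, hy, hy0⟩ := hz
    have a1 : 0 < -4 * (l.im * m.im) := by rw [h1] at hy; exact (div_pos_iff_of_pos_right hn).1 hy
    have a2 : imPart (quadricParam l m) 0 + imPart (quadricParam l m) 1 < 0 := by
      simp only [mform] at hy
      nlinarith [sq_nonneg (imPart (quadricParam l m) 2)]
    rw [h2] at a2
    have a3 := neg_of_div_neg_left a2 hn.le
    simp only [tube, Tuboid.eps, Set.mem_ofPred_eq]
    constructor <;> nlinarith
  · obtain ⟨-, hy, hd⟩ := hz
    have a1 : -4 * (l.im * m.im) < 0 := by rw [h1] at hy; exact neg_of_div_neg_left hy hn.le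
    have a2 := hd _ he
    rw [det_quadricParam h] at a2
    have a3 := neg_of_div_neg_left a2 hn.le
    simp only [tube, Tuboid.eps, Set.mem_ofPred_eq]
    rcases mul_pos_iff.1 (by linarith : 0 < l.im * m.im) with ⟨p, q⟩ | ⟨p, q⟩
    · nlinarith [mul_nonneg p.le hm, mul_nonneg q.le hl]
    · constructor <;> linarith
  · obtain ⟨-, hy, hd⟩ := hz
    have a1 : -4 * (l.im * m.im) < 0 := by rw [h1] at hy; exact neg_of_div_neg_left hy hn.le
    have a2 := hd _ he
    rw [det_quadricParam h] at a2
    have a3 := (div_pos_iff_of_pos_right hn).1 a2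
    simp only [tube, Tuboid.eps, Set.mem_ofPred_eq]
    rcases mul_pos_iff.1 (by linarith : 0 < l.im * m.im) with ⟨p, q⟩ | ⟨p, q⟩
    · constructor <;> linarith
    · nlinarith [mul_nonneg (neg_nonneg.2 p.le) hm, mul_nonneg (neg_nonneg.2 q.le) hl]

theorem quadricCoord_mem_tube {t : Tuboid} {z : Fin 3 → ℂ} (hz : z ∈ t.domain) :
    quadricCoord z ∈ tube t.eps := by
  refine quadricParam_mem_domain_imp (quadricCoord_fst_ne_snd (t.add_ne_zero hz)) ?_
  have h := quadricParam_quadricCoord (t.mem_quadric hz) (t.add_ne_zero hz)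
  exact h.symm ▸ hz

/-! ### The invariant measure in the coordinates `(l, m)` -/

/-- The parametrization of the hyperboloid by `ℝ × ℝ`. On the diagonal it takes the junk value
`0`. -/
noncomputable def hypParam (p : ℝ × ℝ) : Fin 3 → ℝ := quadricParam p.1 p.2

/-- The projection of `hypParam` to the coordinates `(x₁, x₂)`. -/
noncomputable def hypParamProj (p : ℝ × ℝ) : ℝ × ℝ := (hypParam p 1, hypParam p 2)

/-- The measure `dl dm / (l - m)²` on `ℝ²`. -/
noncomputable def paramMeasure : Measure (ℝ × ℝ) :=
  (volume : Measure (ℝ × ℝ)).withDensity fun p => ENNReal.ofReal (1 / (p.1 - p.2) ^ 2)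

/-- The sheet `x₀ = s √(x₁² + x₂² - 1)` as a graph over the `(x₁, x₂)`-plane. -/
noncomputable def sheetGraph (s : ℝ) (p : ℝ × ℝ) : Fin 3 → ℝ :=
  ![s * √(p.1 ^ 2 + p.2 ^ 2 - 1), p.1, p.2]

/-- The points of the parameter plane over the sheet `s x₀ > 0`. -/
def sheetRegion (s : ℝ) : Set (ℝ × ℝ) := {p | p.1 ≠ p.2 ∧ 0 < s * hypParam p 0}

theorem measurable_hypParam : Measurable hypParam := by
  refine measurable_pi_iff.2 fun i => ?_
  fin_cases i <;> simp only [hypParam, quadricParam] <;> simp <;> fun_prop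

theorem measurable_sheetGraph (s : ℝ) : Measurable (sheetGraph s) := by
  refine measurable_pi_iff.2 fun i => ?_
  fin_cases i <;> simp only [sheetGraph] <;> simp <;> fun_prop

theorem measurableSet_sheetRegion (s : ℝ) : MeasurableSet (sheetRegion s) := by
  refine MeasurableSet.inter ?_ ?_
  · exact (measurableSet_eq_fun measurable_fst measurable_snd).compl
  · exact measurableSet_lt measurable_const
      (((measurable_pi_apply 0).comp measurable_hypParam).const_mul s)

/-- The derivative of `hypParamProj` at `p`. -/
noncomputable def fderivHypParamProj (p : ℝ × ℝ) : ℝ × ℝ →L[ℝ] ℝ × ℝ :=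
  (Matrix.toLin (.finTwoProd ℝ) (.finTwoProd ℝ)
    !![(p.2 ^ 2 - 1) / (p.1 - p.2) ^ 2, (1 - p.1 ^ 2) / (p.1 - p.2) ^ 2;
      -2 * p.2 / (p.1 - p.2) ^ 2, 2 * p.1 / (p.1 - p.2) ^ 2]).toContinuousLinearMap

theorem hasFDerivAt_hypParamProj {p : ℝ × ℝ} (hp : p.1 ≠ p.2) :
    HasFDerivAt hypParamProj (fderivHypParamProj p) p := by
  have hd : p.1 - p.2 ≠ 0 := sub_ne_zero.2 hp
  have h1 : HasFDerivAt (fun q : ℝ × ℝ => q.1) (ContinuousLinearMap.fst ℝ ℝ ℝ) p := hasFDerivAt_fst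
  have h2 : HasFDerivAt (fun q : ℝ × ℝ => q.2) (ContinuousLinearMap.snd ℝ ℝ ℝ) p := hasFDerivAt_snd
  have hD := h1.sub h2
  have hI : HasFDerivAt (fun q : ℝ × ℝ => (q.1 - q.2)⁻¹) _ p :=
    (hasDerivAt_inv hd).comp_hasFDerivAt p hD
  have key := (((h1.mul h2).const_sub 1).mul hI).prodMk ((h1.add h2).mul hI)
  have e : hypParamProj = fun q : ℝ × ℝ =>
      ((1 - q.1 * q.2) * (q.1 - q.2)⁻¹, (q.1 + q.2) * (q.1 - q.2)⁻¹) := by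
    ext q <;> simp [hypParamProj, hypParam, quadricParam, div_eq_mul_inv]
  rw [e]
  refine HasFDerivAt.congr_fderiv key ?_
  unfold fderivHypParamProj
  rw [Matrix.toLin_finTwoProd_toContinuousLinearMap]
  ext <;> simp <;> field_simp <;> ring

theorem det_fderivHypParamProj {p : ℝ × ℝ} (hp : p.1 ≠ p.2) :
    (fderivHypParamProj p).det = -2 * hypParam p 0 / (p.1 - p.2) ^ 2 := by
  have hd : p.1 - p.2 ≠ 0 := sub_ne_zero.2 hp
  unfold fderivHypParamProj
  simp only [LinearMap.det_toContinuousLinearMap, LinearMap.det_toLin, Matrix.det_fin_two_of,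
    hypParam, quadricParam, Matrix.cons_val_zero]
  field_simp
  ring

theorem hypParam_sq {p : ℝ × ℝ} (hp : p.1 ≠ p.2) :
    hypParam p 1 ^ 2 + hypParam p 2 ^ 2 - 1 = hypParam p 0 ^ 2 := by
  have h := mform_quadricParam hp
  simp only [mform] at h
  simp only [hypParam]
  linear_combination -h

theorem sqrt_hypParam {s : ℝ} (hs : s = 1 ∨ s = -1) {p : ℝ × ℝ} (hp : p ∈ sheetRegion s) :
    √(hypParam p 1 ^ 2 + hypParam p 2 ^ 2 - 1) = s * hypParam p 0 := by
  rw [hypParam_sq hp.1, ← abs_of_pos hp.2, Real.sqrt_sq_eq_abs]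
  rcases hs with rfl | rfl <;> simp

theorem sheetGraph_hypParamProj {s : ℝ} (hs : s = 1 ∨ s = -1) {p : ℝ × ℝ}
    (hp : p ∈ sheetRegion s) : sheetGraph s (hypParamProj p) = hypParam p := by
  have h := sqrt_hypParam hs hp
  have hs2 : s * s = 1 := by rcases hs with rfl | rfl <;> norm_num
  ext i
  fin_cases i <;> simp [sheetGraph, hypParamProj, h]
  rw [← mul_assoc, hs2, one_mul]

theorem injOn_hypParamProj {s : ℝ} (hs : s = 1 ∨ s = -1) :
    Set.InjOn hypParamProj (sheetRegion s) := by
  refine Set.LeftInvOn.injOn (f₁' := fun x => quadricCoord (sheetGraph s x)) fun p hp => ?_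
  simp only [sheetGraph_hypParamProj hs hp]
  exact quadricCoord_quadricParam hp.1

theorem image_hypParamProj {s : ℝ} (hs : s = 1 ∨ s = -1) :
    hypParamProj '' sheetRegion s
      = {p : ℝ × ℝ | 1 < p.1 ^ 2 + p.2 ^ 2} ∩ {p | sheetGraph s p 0 + sheetGraph s p 1 ≠ 0} := by
  have hs2 : s ^ 2 = 1 := by rcases hs with rfl | rfl <;> norm_num
  ext x
  constructor
  · rintro ⟨p, hp, rfl⟩
    refine ⟨?_, ?_⟩
    · have h := hypParam_sq hp.1
      have h0 : hypParam p 0 ≠ 0 := fun h => by simpa [h] using hp.2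
      have := sq_pos_of_ne_zero h0
      change 1 < hypParam p 1 ^ 2 + hypParam p 2 ^ 2
      linarith
    · have hd : p.1 - p.2 ≠ 0 := sub_ne_zero.2 hp.1
      have e : hypParam p 0 + hypParam p 1 = 2 / (p.1 - p.2) := by
        simp only [hypParam, quadricParam, Matrix.cons_val_zero, Matrix.cons_val_one]
        field_simp
        ring
      simp only [Set.mem_ofPred_eq, sheetGraph_hypParamProj hs hp, e]
      exact div_ne_zero two_ne_zero hd
  · rintro ⟨hx, hne⟩
    have hx' : 0 < x.1 ^ 2 + x.2 ^ 2 - 1 := by have : 1 < x.1 ^ 2 + x.2 ^ 2 := hx; linarith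
    have hq : sheetGraph s x ∈ quadric ℝ := by
      change mform _ _ = _
      simp only [mform, sheetGraph, Matrix.cons_val_zero, Matrix.cons_val_one, Matrix.cons_val]
      have := Real.sq_sqrt hx'.le
      linear_combination s ^ 2 * this + (x.1 ^ 2 + x.2 ^ 2 - 1) * hs2
    have hp : hypParam (quadricCoord (sheetGraph s x)) = sheetGraph s x :=
      quadricParam_quadricCoord hq hne
    refine ⟨quadricCoord (sheetGraph s x), ⟨quadricCoord_fst_ne_snd hne, ?_⟩, ?_⟩
    · rw [hp]
      simp only [sheetGraph, Matrix.cons_val_zero]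
      rw [← mul_assoc, ← sq, hs2, one_mul]
      exact Real.sqrt_pos.2 hx'
    · rw [hypParamProj, hp]
      simp [sheetGraph]

/-- The points of a sheet with `x₀ + x₁ = 0` have `x₂ = ± 1`. -/
theorem ae_sheetGraph_add_ne_zero {s : ℝ} (hs : s = 1 ∨ s = -1) :
    ∀ᵐ p : ℝ × ℝ, 1 < p.1 ^ 2 + p.2 ^ 2 → sheetGraph s p 0 + sheetGraph s p 1 ≠ 0 := by
  have hs2 : s ^ 2 = 1 := by rcases hs with rfl | rfl <;> norm_num
  have h1 : ∀ᵐ ξ : ℝ × ℝ, ξ.2 ≠ 1 :=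
    Measure.quasiMeasurePreserving_snd.ae (Measure.ae_ne volume 1)
  have h2 : ∀ᵐ ξ : ℝ × ℝ, ξ.2 ≠ -1 :=
    Measure.quasiMeasurePreserving_snd.ae (Measure.ae_ne volume (-1))
  filter_upwards [h1, h2] with p k1 k2 hp h0
  simp only [sheetGraph, Matrix.cons_val_zero, Matrix.cons_val_one] at h0
  have h3 := Real.sq_sqrt (show 0 ≤ p.1 ^ 2 + p.2 ^ 2 - 1 by linarith)
  have h4 : (p.2 - 1) * (p.2 + 1) = 0 := by
    linear_combination (-p.1 + s * √(p.1 ^ 2 + p.2 ^ 2 - 1)) * h0 - s ^ 2 * h3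
      - (p.1 ^ 2 + p.2 ^ 2 - 1) * hs2
  rcases mul_eq_zero.1 h4 with h | h
  · exact k1 (by linarith)
  · exact k2 (by linarith)

theorem lintegral_sheetMeasure {s : ℝ} (hs : s = 1 ∨ s = -1) {g : (Fin 3 → ℝ) → ℝ≥0∞}
    (hg : Measurable g) :
    ∫⁻ x, g x ∂(sheetMeasure s)
      = ∫⁻ p in sheetRegion s, ENNReal.ofReal (1 / (p.1 - p.2) ^ 2) * g (hypParam p) := by
  have hρ : Measurable fun p : ℝ × ℝ => ENNReal.ofReal (1 / (2 * √(p.1 ^ 2 + p.2 ^ 2 - 1))) := by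
    fun_prop
  have e : sheetMeasure s = Measure.map (sheetGraph s)
      (((volume : Measure (ℝ × ℝ)).restrict {p : ℝ × ℝ | 1 < p.1 ^ 2 + p.2 ^ 2}).withDensity
      (fun p => ENNReal.ofReal (1 / (2 * √(p.1 ^ 2 + p.2 ^ 2 - 1))))) := rfl
  rw [e, lintegral_map hg (measurable_sheetGraph s),
    lintegral_withDensity_eq_lintegral_mul _ hρ
      (show Measurable fun p => g (sheetGraph s p) from hg.comp (measurable_sheetGraph s))]
  have hset : ({p : ℝ × ℝ | 1 < p.1 ^ 2 + p.2 ^ 2} : Set (ℝ × ℝ)) =ᵐ[volume]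
      hypParamProj '' sheetRegion s := by
    rw [image_hypParamProj hs]
    filter_upwards [ae_sheetGraph_add_ne_zero hs] with p hp
    exact propext ⟨fun h => ⟨h, hp h⟩, fun h => h.1⟩
  rw [Measure.restrict_congr_set hset,
    lintegral_image_eq_lintegral_abs_det_fderiv_mul volume (measurableSet_sheetRegion s)
      (fun p hp => (hasFDerivAt_hypParamProj hp.1).hasFDerivWithinAt) (injOn_hypParamProj hs)]
  refine setLIntegral_congr_fun (measurableSet_sheetRegion s) fun p hp => ?_
  have hd : 0 < (p.1 - p.2) ^ 2 := sq_pos_of_ne_zero (sub_ne_zero.2 hp.1)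
  have habs : |hypParam p 0| = s * hypParam p 0 := by
    rw [← abs_of_pos hp.2]
    rcases hs with rfl | rfl <;> simp
  simp only [Pi.mul_apply, sheetGraph_hypParamProj hs hp]
  rw [← mul_assoc, ← ENNReal.ofReal_mul (abs_nonneg _)]
  congr 2
  simp only [hypParamProj, sqrt_hypParam hs hp, det_fderivHypParamProj hp.1]
  rw [abs_div, abs_mul, habs, abs_of_pos hd]
  have h0 := hp.2.ne'
  have hs0 := left_ne_zero_of_mul h0
  have hx0 := right_ne_zero_of_mul h0
  norm_num
  field_simp

theorem ae_fst_ne_snd : ∀ᵐ p : ℝ × ℝ, p.1 ≠ p.2 := by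
  have : (volume : Measure (ℝ × ℝ)) {p : ℝ × ℝ | ¬ p.1 ≠ p.2} = 0 := by
    rw [Measure.volume_eq_prod, Measure.measure_prod_null]
    · refine Eventually.of_forall fun x => ?_
      refine (Set.Subsingleton.measure_zero ?_ _)
      intro a ha b hb
      simp only [Set.mem_preimage, Set.mem_ofPred_eq, not_not] at ha hb
      rw [← ha, ← hb]
    · simpa using measurableSet_eq_fun measurable_fst measurable_snd
  exact this

theorem ae_hypParam_zero_ne_zero : ∀ᵐ p : ℝ × ℝ, p.1 ≠ p.2 → hypParam p 0 ≠ 0 := by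
  have : (volume : Measure (ℝ × ℝ)) {p : ℝ × ℝ | ¬ (1 + p.1 * p.2 ≠ 0)} = 0 := by
    rw [Measure.volume_eq_prod, Measure.measure_prod_null]
    · refine Eventually.of_forall fun x => ?_
      refine (Set.Subsingleton.measure_zero ?_ _)
      intro a ha b hb
      simp only [Set.mem_preimage, Set.mem_ofPred_eq, not_not] at ha hb
      have hx : x ≠ 0 := fun h => by simp [h] at ha
      exact mul_left_cancel₀ hx (by linarith)
    · simpa using measurableSet_eq_fun (f := fun p : ℝ × ℝ => 1 + p.1 * p.2) (by fun_prop)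
        measurable_const
  have h : ∀ᵐ p : ℝ × ℝ, 1 + p.1 * p.2 ≠ 0 := this
  filter_upwards [h] with p hp hne
  simpa [hypParam, quadricParam] using div_ne_zero hp (sub_ne_zero.2 hne)

/-- The invariant measure of the hyperboloid is `dl dm / (l - m)²` in the coordinates `(l, m)`. -/
theorem hypMeasure_eq_map : hypMeasure = Measure.map hypParam paramMeasure := by
  refine Measure.ext_of_lintegral _ fun g hg => ?_
  have hρ : Measurable fun p : ℝ × ℝ => ENNReal.ofReal (1 / (p.1 - p.2) ^ 2) := by fun_prop
  rw [hypMeasure, lintegral_add_measure, lintegral_sheetMeasure (Or.inl rfl) hg,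
    lintegral_sheetMeasure (Or.inr rfl) hg, lintegral_map hg measurable_hypParam, paramMeasure,
    lintegral_withDensity_eq_lintegral_mul _ hρ
      (show Measurable fun p => g (hypParam p) from hg.comp measurable_hypParam),
    ← lintegral_union (measurableSet_sheetRegion _)]
  · have : (sheetRegion 1 ∪ sheetRegion (-1) : Set (ℝ × ℝ)) =ᵐ[volume]
        (Set.univ : Set (ℝ × ℝ)) := by
      filter_upwards [ae_fst_ne_snd, ae_hypParam_zero_ne_zero] with p h1 h2
      refine propext ⟨fun _ => trivial, fun _ => ?_⟩
      rcases lt_or_gt_of_ne (h2 h1) with h | h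
      · exact Or.inr ⟨h1, by linarith⟩
      · exact Or.inl ⟨h1, by linarith⟩
    rw [Measure.restrict_congr_set this, Measure.restrict_univ]
    rfl
  · rw [Set.disjoint_left]
    rintro p ⟨-, h1⟩ ⟨-, h2⟩
    linarith

/-! ### The isometry of `L²(X, dσ)` onto `L²(ℝ × ℝ)` -/

theorem measurable_density : Measurable fun p : ℝ × ℝ => ENNReal.ofReal (1 / (p.1 - p.2) ^ 2) := by
  fun_prop

theorem paramMeasure_absolutelyContinuous :
    paramMeasure ≪ (volume : Measure (ℝ × ℝ)) :=
  withDensity_absolutelyContinuous _ _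

theorem quasiMeasurePreserving_hypParam :
    Measure.QuasiMeasurePreserving hypParam volume hypMeasure := by
  refine ⟨measurable_hypParam, ?_⟩
  rw [hypMeasure_eq_map]
  refine Measure.AbsolutelyContinuous.map ?_ measurable_hypParam
  refine withDensity_absolutelyContinuous' measurable_density.aemeasurable ?_
  filter_upwards [ae_fst_ne_snd] with p hp
  have : 0 < (p.1 - p.2) ^ 2 := sq_pos_of_ne_zero (sub_ne_zero.2 hp)
  exact (ENNReal.ofReal_pos.2 (by positivity)).ne'

/-- The image `(l - m)⁻¹ f(x(l, m))` of a function on the hyperboloid under the isometry onto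
`L²(ℝ²)`. -/
noncomputable def toPlane (f : (Fin 3 → ℝ) → ℂ) (p : ℝ × ℝ) : ℂ :=
  ((p.1 - p.2 : ℝ) : ℂ)⁻¹ * f (hypParam p)

/-- The function on the hyperboloid with the given image in `L²(ℝ²)`. -/
noncomputable def ofPlane (g : ℝ × ℝ → ℂ) (x : Fin 3 → ℝ) : ℂ :=
  (((quadricCoord x).1 - (quadricCoord x).2 : ℝ) : ℂ) * g (quadricCoord x)

theorem ofPlane_hypParam (g : ℝ × ℝ → ℂ) {p : ℝ × ℝ} (hp : p.1 ≠ p.2) :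
    ofPlane g (hypParam p) = ((p.1 - p.2 : ℝ) : ℂ) * g p := by
  have : quadricCoord (hypParam p) = p := quadricCoord_quadricParam hp
  rw [ofPlane, this]

theorem toPlane_ofPlane (g : ℝ × ℝ → ℂ) {p : ℝ × ℝ} (hp : p.1 ≠ p.2) :
    toPlane (ofPlane g) p = g p := by
  rw [toPlane, ofPlane_hypParam g hp, inv_mul_cancel_left₀]
  exact Complex.ofReal_ne_zero.2 (sub_ne_zero.2 hp)

theorem measurable_toPlane {f : (Fin 3 → ℝ) → ℂ} (hf : Measurable f) : Measurable (toPlane f) :=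
  (by fun_prop : Measurable fun p : ℝ × ℝ => ((p.1 - p.2 : ℝ) : ℂ)⁻¹).mul
    (hf.comp measurable_hypParam)

theorem measurable_ofPlane {g : ℝ × ℝ → ℂ} (hg : Measurable g) : Measurable (ofPlane g) := by
  have h : Measurable (quadricCoord : (Fin 3 → ℝ) → ℝ × ℝ) := by
    unfold quadricCoord
    fun_prop
  exact (Complex.measurable_ofReal.comp ((measurable_fst.comp h).sub (measurable_snd.comp h))).mul
    (hg.comp h)

theorem lintegral_toPlane {f : (Fin 3 → ℝ) → ℂ} (hf : Measurable f) :
    ∫⁻ x, ‖f x‖ₑ ^ 2 ∂hypMeasure = ∫⁻ p, ‖toPlane f p‖ₑ ^ 2 := by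
  have hm : Measurable fun x => ‖f x‖ₑ ^ 2 := hf.enorm.pow_const 2
  rw [hypMeasure_eq_map, lintegral_map hm measurable_hypParam, paramMeasure,
    lintegral_withDensity_eq_lintegral_mul _ measurable_density
      (show Measurable fun p => ‖f (hypParam p)‖ₑ ^ 2 from hm.comp measurable_hypParam)]
  refine lintegral_congr fun p => ?_
  rw [Pi.mul_apply, toPlane, enorm_mul, mul_pow]
  congr 1
  rw [← ofReal_norm, ← ENNReal.ofReal_pow (norm_nonneg _)]
  congr 1
  rw [norm_inv, Complex.norm_real, Real.norm_eq_abs, inv_pow, sq_abs, one_div]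

theorem memLp_two_iff_lintegral_enorm_sq {α : Type*} [MeasurableSpace α] {μ : Measure α}
    {f : α → ℂ} (hf : AEStronglyMeasurable f μ) :
    MemLp f 2 μ ↔ ∫⁻ x, ‖f x‖ₑ ^ 2 ∂μ < ∞ := by
  have h := eLpNorm_nnreal_pow_eq_lintegral (μ := μ) (f := f) (p := 2) two_ne_zero
  have h' : eLpNorm f 2 μ ^ 2 = ∫⁻ x, ‖f x‖ₑ ^ 2 ∂μ := by simpa using h
  rw [← h', ENNReal.pow_lt_top_iff]
  simp [MemLp, hf]

theorem memLp_toPlane (f : Lp ℂ 2 hypMeasure) : MemLp (toPlane f) 2 := by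
  have hf := (Lp.stronglyMeasurable f).measurable
  rw [memLp_two_iff_lintegral_enorm_sq (measurable_toPlane hf).aestronglyMeasurable,
    ← lintegral_toPlane hf, ← memLp_two_iff_lintegral_enorm_sq hf.aestronglyMeasurable]
  exact Lp.memLp f

theorem memLp_ofPlane (g : Lp ℂ 2 (volume : Measure (ℝ × ℝ))) : MemLp (ofPlane g) 2 hypMeasure := by
  have hg := (Lp.stronglyMeasurable g).measurable
  have hf := measurable_ofPlane hg
  rw [memLp_two_iff_lintegral_enorm_sq hf.aestronglyMeasurable, lintegral_toPlane hf]
  have : ∫⁻ p, ‖toPlane (ofPlane g) p‖ₑ ^ 2 = ∫⁻ p, ‖g p‖ₑ ^ 2 := by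
    refine lintegral_congr_ae ?_
    filter_upwards [ae_fst_ne_snd] with p hp
    rw [toPlane_ofPlane _ hp]
  rw [this, ← memLp_two_iff_lintegral_enorm_sq hg.aestronglyMeasurable]
  exact Lp.memLp g

theorem toPlane_toLp_ofPlane_ae_eq (g : Lp ℂ 2 (volume : Measure (ℝ × ℝ))) :
    toPlane ((memLp_ofPlane g).toLp _) =ᵐ[volume] g := by
  filter_upwards [ae_fst_ne_snd,
    quasiMeasurePreserving_hypParam.ae_eq_comp (memLp_ofPlane g).coeFn_toLp] with p hp h
  rw [← toPlane_ofPlane g hp, toPlane, toPlane]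
  congr 1

/-! ### The Cauchy integral on the hyperboloid -/

theorem measurable_cauchyIntegrand (f : Lp ℂ 2 hypMeasure) (z : Fin 3 → ℂ) :
    Measurable (cauchyIntegrand f z) := by
  refine (Lp.stronglyMeasurable f).measurable.div ?_
  simp only [mform, toComplex, Pi.sub_apply]
  fun_prop

theorem density_smul_cauchyIntegrand (f : Lp ℂ 2 hypMeasure) {w : ℂ × ℂ} (hw : w.1 ≠ w.2)
    {p : ℝ × ℝ} (hp : p.1 ≠ p.2) :
    (ENNReal.ofReal (1 / (p.1 - p.2) ^ 2)).toReal •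
        cauchyIntegrand f (quadricParam w.1 w.2) (hypParam p)
      = -(w.1 - w.2) / 4 * (toPlane f p * cauchyKernel w p) := by
  have hd : ((p.1 : ℂ) - p.2) ≠ 0 := by
    rw [← Complex.ofReal_sub]
    exact Complex.ofReal_ne_zero.2 (sub_ne_zero.2 hp)
  have hd' : (p.1 : ℂ) ≠ p.2 := sub_ne_zero.1 hd
  rw [ENNReal.toReal_ofReal (by positivity), cauchyIntegrand, hypParam, toComplex_quadricParam,
    mform_quadricParam_sub hd' hw, toPlane, cauchyKernel, hypParam, Complex.real_smul]
  push_cast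
  rw [div_div_eq_mul_div, div_eq_mul_inv (_ * _) (-4 * _), mul_inv]
  field_simp

theorem integrable_cauchyIntegrand (t : Tuboid) (f : Lp ℂ 2 hypMeasure) {w : ℂ × ℂ}
    (ht : w ∈ tube t.eps) (hw : w.1 ≠ w.2) :
    Integrable (cauchyIntegrand f (quadricParam w.1 w.2)) hypMeasure := by
  rw [hypMeasure_eq_map, integrable_map_measure
    (measurable_cauchyIntegrand f _).aestronglyMeasurable measurable_hypParam.aemeasurable,
    paramMeasure, integrable_withDensity_iff_integrable_smul' measurable_density
      (Eventually.of_forall fun _ => ENNReal.ofReal_lt_top)]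
  refine ((integrable_mul_cauchyKernel t ht (memLp_toPlane f)).const_mul
    (-(w.1 - w.2) / 4)).congr ?_
  filter_upwards [ae_fst_ne_snd] with p hp
  exact (density_smul_cauchyIntegrand f hw hp).symm

theorem integral_cauchyIntegrand (f : Lp ℂ 2 hypMeasure) {w : ℂ × ℂ} (hw : w.1 ≠ w.2) :
    ∫ x, cauchyIntegrand f (quadricParam w.1 w.2) x ∂hypMeasure
      = -(w.1 - w.2) / 4 * ∫ p, toPlane f p * cauchyKernel w p := by
  -- The type of `f` mentions `hypMeasure`, so the measure is rewritten in a statement without `f`.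
  have hmap : ∀ φ : (Fin 3 → ℝ) → ℂ,
      ∫ x, φ x ∂hypMeasure = ∫ x, φ x ∂(Measure.map hypParam paramMeasure) := by
    rw [hypMeasure_eq_map]
    exact fun _ => rfl
  rw [hmap, integral_map measurable_hypParam.aemeasurable
    (measurable_cauchyIntegrand f _).aestronglyMeasurable, paramMeasure,
    integral_withDensity_eq_integral_toReal_smul measurable_density
      (Eventually.of_forall fun _ => ENNReal.ofReal_lt_top), ← integral_const_mul]
  refine integral_congr_ae ?_
  filter_upwards [ae_fst_ne_snd] with p hp
  exact density_smul_cauchyIntegrand f hw hp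

/-- The Cauchy-type integral over the hyperboloid. -/
noncomputable def hypCauchy (t : Tuboid) (f : Lp ℂ 2 hypMeasure) (z : Fin 3 → ℂ) : ℂ :=
  t.sign * (1 / (Real.pi : ℂ) ^ 2) * ∫ x, cauchyIntegrand f z x ∂hypMeasure

theorem hypCauchy_quadricParam (t : Tuboid) (f : Lp ℂ 2 hypMeasure) {w : ℂ × ℂ}
    (hw : w.1 ≠ w.2) :
    hypCauchy t f (quadricParam w.1 w.2) = (w.1 - w.2) * tubeCauchy t (toPlane f) w := by
  rw [hypCauchy, integral_cauchyIntegrand f hw, tubeCauchy]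
  ring

theorem weightedPullback_hypCauchy (t : Tuboid) (f : Lp ℂ 2 hypMeasure) {w : ℂ × ℂ}
    (hw : w.1 ≠ w.2) :
    weightedPullback (hypCauchy t f) w = tubeCauchy t (toPlane f) w := by
  rw [weightedPullback, hypCauchy_quadricParam t f hw, inv_mul_cancel_left₀ (sub_ne_zero.2 hw)]

theorem tubeCauchy_congr_ae (t : Tuboid) {g g' : ℝ × ℝ → ℂ} (h : g =ᵐ[volume] g') (w : ℂ × ℂ) :
    tubeCauchy t g w = tubeCauchy t g' w := by
  rw [tubeCauchy, tubeCauchy]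
  congr 1
  refine integral_congr_ae ?_
  filter_upwards [h] with p hp
  rw [hp]

theorem analyticAt_quadricCoord {z : Fin 3 → ℂ} (hz : z 0 + z 1 ≠ 0) :
    AnalyticAt ℂ (quadricCoord : (Fin 3 → ℂ) → ℂ × ℂ) z := by
  have hi : ∀ i : Fin 3, AnalyticAt ℂ (fun z : Fin 3 → ℂ => z i) z := fun i =>
    (ContinuousLinearMap.proj (R := ℂ) (φ := fun _ : Fin 3 => ℂ) i).analyticAt z
  exact (((hi 2).add analyticAt_const).div ((hi 0).add (hi 1)) hz).prod
    (((hi 2).sub analyticAt_const).div ((hi 0).add (hi 1)) hz)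

theorem hypCauchy_eq_of_mem_domain {t : Tuboid} (f : Lp ℂ 2 hypMeasure) {z : Fin 3 → ℂ}
    (hz : z ∈ t.domain) :
    hypCauchy t f z = ((quadricCoord z).1 - (quadricCoord z).2) *
      tubeCauchy t (toPlane f) (quadricCoord z) := by
  rw [← hypCauchy_quadricParam t f (quadricCoord_fst_ne_snd (t.add_ne_zero hz)),
    quadricParam_quadricCoord (t.mem_quadric hz) (t.add_ne_zero hz)]

theorem holomorphicOnQuadric_hypCauchy (t : Tuboid) (f : Lp ℂ 2 hypMeasure) :
    HolomorphicOnQuadric (hypCauchy t f) t.domain := by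
  intro z hz
  have hc := analyticAt_quadricCoord (t.add_ne_zero hz)
  have hT := analyticAt_tubeCauchy t (memLp_toPlane f) (quadricCoord_mem_tube hz)
  refine ⟨fun z => ((quadricCoord z).1 - (quadricCoord z).2) *
      tubeCauchy t (toPlane f) (quadricCoord z),
    ((analyticAt_fst.fun_comp hc).sub (analyticAt_snd.fun_comp hc)).mul (hT.fun_comp hc), ?_⟩
  filter_upwards [self_mem_nhdsWithin] with z' hz'
  exact hypCauchy_eq_of_mem_domain f hz'

theorem integrable_cauchyIntegrand_of_mem_domain {t : Tuboid} (f : Lp ℂ 2 hypMeasure)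
    {z : Fin 3 → ℂ} (hz : z ∈ t.domain) : Integrable (cauchyIntegrand f z) hypMeasure := by
  have h := integrable_cauchyIntegrand t f (quadricCoord_mem_tube hz)
    (quadricCoord_fst_ne_snd (t.add_ne_zero hz))
  rwa [quadricParam_quadricCoord (t.mem_quadric hz) (t.add_ne_zero hz)] at h

/-! ### The decomposition -/

/-- The image of `f` under the isometry of `L²(X, dσ)` onto `L²(ℝ²)`. -/
noncomputable def planeLp (f : Lp ℂ 2 hypMeasure) : Lp ℂ 2 (volume : Measure (ℝ × ℝ)) :=
  (memLp_toPlane f).toLp _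

/-- The component of `f` that is a boundary value from the tuboid `t`: the Hardy projection,
transported to the hyperboloid. -/
noncomputable def tuboidProj (t : Tuboid) (f : Lp ℂ 2 hypMeasure) : Lp ℂ 2 hypMeasure :=
  (memLp_ofPlane (hardyProj t (planeLp f))).toLp _

theorem tuboidProj_sum (f : Lp ℂ 2 hypMeasure) :
    f = tuboidProj .plus f + tuboidProj .minus f + tuboidProj .right f + tuboidProj .left f := by
  have hsum := hardyProj_sum (planeLp f)
  simp only [tuboidProj, ← MemLp.toLp_add]
  refine Lp.ext (EventuallyEq.trans ?_ (MemLp.coeFn_toLp _).symm)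
  have hm : ∀ t, Measurable (ofPlane (hardyProj t (planeLp f))) := fun t =>
    measurable_ofPlane (Lp.stronglyMeasurable _).measurable
  -- The type of `f` mentions `hypMeasure`, so the measure is rewritten in a statement without `f`.
  have hmap : ∀ P : (Fin 3 → ℝ) → Prop,
      (∀ᵐ x ∂hypMeasure, P x) ↔ ∀ᵐ x ∂(Measure.map hypParam paramMeasure), P x := by
    rw [hypMeasure_eq_map]
    exact fun _ => Iff.rfl
  rw [EventuallyEq, hmap, ae_map_iff measurable_hypParam.aemeasurable]
  · refine paramMeasure_absolutelyContinuous.ae_le ?_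
    have h1 := (memLp_toPlane f).coeFn_toLp
    have h2 := Lp.coeFn_add (hardyProj .plus (planeLp f) + hardyProj .minus (planeLp f)
      + hardyProj .right (planeLp f)) (hardyProj .left (planeLp f))
    have h3 := Lp.coeFn_add (hardyProj .plus (planeLp f) + hardyProj .minus (planeLp f))
      (hardyProj .right (planeLp f))
    have h4 := Lp.coeFn_add (hardyProj .plus (planeLp f)) (hardyProj .minus (planeLp f))
    rw [← hsum] at h2
    filter_upwards [ae_fst_ne_snd, h1, h2, h3, h4] with p hp k1 k2 k3 k4
    simp only [Pi.add_apply] at k2 k3 k4 ⊢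
    rw [k3, k4, planeLp, k1, toPlane] at k2
    simp only [ofPlane_hypParam _ hp, ← mul_add]
    rw [← mul_inv_cancel_left₀ (Complex.ofReal_ne_zero.2 (sub_ne_zero.2 hp)) (f (hypParam p)), k2]
    rfl
  · exact measurableSet_eq_fun (Lp.stronglyMeasurable f).measurable
      ((((hm _).add (hm _)).add (hm _)).add (hm _))

theorem toPlane_tuboidProj_ae_eq (t : Tuboid) (f : Lp ℂ 2 hypMeasure) :
    toPlane (tuboidProj t f) =ᵐ[volume] hardyProj t (planeLp f) :=
  toPlane_toLp_ofPlane_ae_eq _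

theorem tubeCauchy_toPlane (t : Tuboid) (f : Lp ℂ 2 hypMeasure) (w : ℂ × ℂ) :
    tubeCauchy t (toPlane f) w = tubeCauchy t (planeLp f) w :=
  tubeCauchy_congr_ae t (memLp_toPlane f).coeFn_toLp.symm w

theorem hypCauchy_tuboidProj {t : Tuboid} (f : Lp ℂ 2 hypMeasure) {z : Fin 3 → ℂ}
    (hz : z ∈ t.domain) : hypCauchy t (tuboidProj t f) z = hypCauchy t f z := by
  rw [hypCauchy_eq_of_mem_domain _ hz, hypCauchy_eq_of_mem_domain _ hz, tubeCauchy_toPlane t f,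
    tubeCauchy_congr_ae t (toPlane_tuboidProj_ae_eq t f),
    tubeCauchy_hardyProj t (quadricCoord_mem_tube hz)]

theorem isBoundaryValue_hypCauchy (t : Tuboid) (f : Lp ℂ 2 hypMeasure) :
    IsBoundaryValue t (hypCauchy t f) (tuboidProj t f) := by
  refine (tendsto_lintegral_tubeCauchy_sub_hardyProj t (planeLp f)).congr fun η => ?_
  refine lintegral_congr_ae ?_
  filter_upwards [ae_fst_ne_snd, toPlane_tuboidProj_ae_eq t f] with p hp h
  -- In the chiral tubes the translates of `ℝ²` may meet the diagonal, but only over real `l = m`.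
  have hne : (tubePoint t.eps η p).1 ≠ (tubePoint t.eps η p).2 := fun h =>
    hp (congrArg Complex.re h)
  rw [weightedPullback_hypCauchy t f hne, tubeCauchy_toPlane, ← h]
  rfl

theorem hypCauchy_mem_tuboidHardy (t : Tuboid) (f : Lp ℂ 2 hypMeasure) :
    hypCauchy t f ∈ tuboidHardy t := by
  refine ⟨holomorphicOnQuadric_hypCauchy t f, ⟨_, isBoundaryValue_hypCauchy t f⟩,
    tubeCauchy t (planeLp f), ⟨fun w hw => ?_, ‖planeLp f‖₊ ^ 2, fun η h1 h2 => ?_⟩,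
    fun w _ hne => ?_⟩
  · exact (analyticAt_tubeCauchy t (Lp.memLp _) hw).differentiableAt.differentiableWithinAt
  · simpa [enorm] using lintegral_tubeCauchy_le t (planeLp f) h1 h2
  · rw [weightedPullback_hypCauchy t f hne, tubeCauchy_toPlane]

theorem theorem1 (f : Lp ℂ 2 hypMeasure) :
    ∃ (fc : Tuboid → Lp ℂ 2 hypMeasure) (F : Tuboid → (Fin 3 → ℂ) → ℂ),
      f = fc .plus + fc .minus + fc .right + fc .left ∧
      ∀ t : Tuboid,
        F t ∈ tuboidHardy t ∧
        IsBoundaryValue t (F t) (fc t) ∧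
        ∀ z ∈ t.domain,
          (Integrable (cauchyIntegrand f z) hypMeasure ∧
            F t z = t.sign * (1 / (Real.pi : ℂ) ^ 2) *
              ∫ x, cauchyIntegrand f z x ∂hypMeasure) ∧
          (Integrable (cauchyIntegrand (fc t) z) hypMeasure ∧
            F t z = t.sign * (1 / (Real.pi : ℂ) ^ 2) *
              ∫ x, cauchyIntegrand (fc t) z x ∂hypMeasure) :=
  ⟨fun t => tuboidProj t f, fun t => hypCauchy t f, tuboidProj_sum f, fun t =>
    ⟨hypCauchy_mem_tuboidHardy t f, isBoundaryValue_hypCauchy t f, fun _ hz =>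
      ⟨⟨integrable_cauchyIntegrand_of_mem_domain f hz, rfl⟩,
        integrable_cauchyIntegrand_of_mem_domain _ hz, (hypCauchy_tuboidProj f hz).symm⟩⟩⟩
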